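/- Fix $\Delta>0$ and an integer $d\ge 0$, and let $M\subset[0,\Delta]^d$ be finite with the $\ell_1$ metric. For distributions $p,q$ on $M$, $EMD(p,q)$ is the minimum of $\sum_{x,y}f(x,y)\|x-y\|_1$ over all $f:M\times M\to[0,\infty)$ with $\sum_y f(x,y)=p(x)$ and $\sum_x f(x,y)=q(y)$. An EMD-closeness tester on $M$ is a randomized algorithm that, given $\varepsilon>0$ and independent samples from $p$ and $q$, accepts with probability at least $2/3$ if $p=q$ and rejects with probability at least $2/3$ if $EMD(p,q)>\varepsilon$. An $\ell_1$-closeness tester with parameters $\varepsilon'>0$, $\delta\in(0,1)$ on a finite set accepts with probability at least $1-\delta$ if $p=q$ and rejects with probability at least $1-\delta$ if $\|p-q\|_1>\varepsilon'$. For $i\ge 1$ let the $i$-coarsening $p^{(i)}$ be the distribution that $p$ induces on the $2^{di}$ cells of the grid of side length $\Delta/2^i$ on $[0,\Delta]^d$. Let $L=\max(0,\lceil\log_2(2\Delta d/\varepsilon)\rceil)$. The algorithm EMD-Closeness-Tester does the following: for $i=1,\dots,L$ it runs, with fresh samples, an $\ell_1$-closeness tester on $p^{(i)},q^{(i)}$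 with distance parameter $\frac{\varepsilon 2^{i-2}}{\Delta d L}$ and failure probability $\frac1{3L}$, and it rejects if that run rejects; if no run rejects, it accepts. Then: 1. Whatever $\ell_1$-closeness tester is used as the subroutine, EMD-Closeness-Tester is an EMD-closeness tester on every finite $M\subset[0,\Delta]^d$. 2. The $\ell_1$-closeness tester can be chosen (once for all $d,\Delta,\varepsilon$) so that EMD-Closeness-Tester takes $\tilde O((2\Delta d/\varepsilon)^{2d/3})$ samples when $d\ge 6$ is fixed, and $\tilde O((\Delta/\varepsilon)^2)$ samples when $d\le 2$. Precisely, there is an integer $k\ge0$ such that for all $\Delta,\varepsilon>0$ the worst-case total number of samples is at most - $C_d\,(2\Delta d/\varepsilon)^{2d/3}\log^k(2+2\Delta d/\varepsilon)$ for each $d\ge 6$, with $C_d$ depending only on $d$; - $C\,(2^{L})^{2d/3}\,(d\log(2+2\Delta d/\varepsilon))^k$ for all $d\ge 6$, with $C$ an absolute constant (here $2^L=2\Delta d/\varepsilon$ if $2\Delta d/\varepsilon\ge1$ is a power of two); - $C'\,(\Delta/\varepsilon)^2\log^k(2+\Delta/\varepsilon)$ for all $d\le 2$, with $C'$ an absolute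 constant. -/

import Mathlib

/-! ### Randomized algorithms with sample access to two unknown distributions -/

/-- A randomized algorithm with output in `α` that can draw fresh independent samples from
two unknown distributions `p` and `q` on `X`, adaptively, and has internal randomness.
Every run terminates, since the type is inductive. -/
inductive SampleAlg (X : Type) (α : Type) : Type where
  /-- stop with output `a` -/
  | ret (a : α) : SampleAlg X α
  /-- draw a fresh sample `x` from `p` and continue with `k x` -/
  | drawP (k : X → SampleAlg X α) : SampleAlg X α
  /-- draw a fresh sample `x` from `q` and continue with `k x` -/
  | drawQ (k : X → SampleAlg X α) : SampleAlg X α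
  /-- draw `n` from the known distribution `μ` (internal randomness) and continue with `k n` -/
  | rand (μ : PMF ℕ) (k : ℕ → SampleAlg X α) : SampleAlg X α

namespace SampleAlg

variable {X Y α β : Type}

/-- The law of the output when the two unknown distributions are `p` and `q`. -/
noncomputable def run (p q : PMF X) : SampleAlg X α → PMF α
  | ret a => PMF.pure a
  | drawP k => p.bind fun x => run p q (k x)
  | drawQ k => q.bind fun x => run p q (k x)
  | rand μ k => μ.bind fun n => run p q (k n)

/-- The number of samples drawn in the worst case, from `p` and `q` together. -/
noncomputable def samples : SampleAlg X α → ℕ∞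
  | ret _ => 0
  | drawP k => 1 + ⨆ x, samples (k x)
  | drawQ k => 1 + ⨆ x, samples (k x)
  | rand _ k => ⨆ n, samples (k n)

/-- Sequential composition. -/
def bind (f : α → SampleAlg X β) : SampleAlg X α → SampleAlg X β
  | ret a => f a
  | drawP k => drawP fun x => bind f (k x)
  | drawQ k => drawQ fun x => bind f (k x)
  | rand μ k => rand μ fun n => bind f (k n)

/-- Run an algorithm for distributions on `Y` with samples from distributions on `X`, by
replacing each sample `x` by `g x`. -/
def comap (g : X → Y) : SampleAlg Y α → SampleAlg X α
  | ret a => ret a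
  | drawP k => drawP fun x => comap g (k (g x))
  | drawQ k => drawQ fun x => comap g (k (g x))
  | rand μ k => rand μ fun n => comap g (k n)

/-- `comap g` is the algorithm run on the distributions that `g` induces on `Y`. -/
theorem run_comap (g : X → Y) (A : SampleAlg Y α) (p q : PMF X) :
    (A.comap g).run p q = A.run (p.map g) (q.map g) := by
  induction A with
  | ret a => rfl
  | drawP k ih => simp [comap, run, ih, PMF.bind_map, Function.comp_def]
  | drawQ k ih => simp [comap, run, ih, PMF.bind_map, Function.comp_def]
  | rand μ k ih => simp [comap, run, ih]

/-- Run the given tests one after the other; reject as soon as one of them rejects, and accept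
if none does (`true` is accept, `false` is reject). -/
def allAccept : List (SampleAlg X Bool) → SampleAlg X Bool
  | [] => ret true
  | A :: As => A.bind fun b => if b then allAccept As else ret false

/-- The probability that the test `A` accepts. -/
noncomputable def acceptProb (A : SampleAlg X Bool) (p q : PMF X) : ℝ := (A.run p q true).toReal

/-- The probability that the test `A` rejects. -/
noncomputable def rejectProb (A : SampleAlg X Bool) (p q : PMF X) : ℝ := (A.run p q false).toReal

end SampleAlg

/-! ### Earth Mover's Distance -/

/-- `f` is a satisfying flow with supply `p` and demand `q`. -/
structure IsSatisfyingFlow {M : Type} [Fintype M] (p q : PMF M) (f : M → M → ℝ) : Prop where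
  nonneg : ∀ x y, 0 ≤ f x y
  supply : ∀ x, ∑ y, f x y = (p x).toReal
  demand : ∀ y, ∑ x, f x y = (q y).toReal

/-- The Earth Mover's Distance of two distributions on a finite metric space: the least cost of
a satisfying flow. -/
noncomputable def EMD {M : Type} [Fintype M] [MetricSpace M] (p q : PMF M) : ℝ :=
  sInf {c : ℝ | ∃ f : M → M → ℝ, IsSatisfyingFlow p q f ∧ c = ∑ x, ∑ y, f x y * dist x y}

/-- `A`, which takes the distance parameter `ε` and samples, is an EMD-closeness tester for
distributions on the finite metric space `M`. -/
def IsEMDClosenessTester {M : Type} [Fintype M] [MetricSpace M]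
    (A : ℝ → SampleAlg M Bool) : Prop :=
  ∀ ε : ℝ, 0 < ε → ∀ p q : PMF M,
    (p = q → 2 / 3 ≤ (A ε).acceptProb p q) ∧
    (ε < EMD p q → 2 / 3 ≤ (A ε).rejectProb p q)

/-! ### Closeness testers for the `ℓ₁` distance -/

/-- The `ℓ₁` distance of two distributions on a finite set. -/
noncomputable def l1Dist {X : Type} [Fintype X] (p q : PMF X) : ℝ :=
  ∑ x, |(p x).toReal - (q x).toReal|

/-- A family of tests: one for each finite domain `X`, distance parameter and failure
probability. -/
abbrev L1Subroutine : Type 1 := ∀ (X : Type) [Fintype X], ℝ → ℝ → SampleAlg X Bool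

/-- `T X ε δ` is an `ℓ₁`-closeness tester on `X` with distance parameter `ε` and failure
probability `δ`. -/
def IsL1ClosenessTester (T : L1Subroutine) : Prop :=
  ∀ (X : Type) [Fintype X] (ε δ : ℝ), 0 < ε → 0 < δ → δ < 1 → ∀ p q : PMF X,
    (p = q → 1 - δ ≤ (T X ε δ).acceptProb p q) ∧
    (ε < l1Dist p q → 1 - δ ≤ (T X ε δ).rejectProb p q)

/-! ### The algorithm -/

/-- `ℝ^d` with the `ℓ₁` metric. -/
abbrev L1Space (d : ℕ) : Type := PiLp 1 (fun _ : Fin d => ℝ)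

/-- The cells of the grid that divides each side of `[0,Δ]^d` into `2^i` intervals. -/
abbrev GridCell (d i : ℕ) : Type := Fin d → Fin (2 ^ i)

/-- The cell, in the grid of side length `Δ / 2^i` over `[0,Δ]^d`, of the point `x`. Cells are
half-open, except that the last cell in each direction contains the face `x j = Δ`. The
`i`-coarsening of `p` is `p.map (gridCell Δ i)`. -/
noncomputable def gridCell {d : ℕ} (Δ : ℝ) (i : ℕ) (x : L1Space d) : GridCell d i := fun j =>
  ⟨min ⌊x j / (Δ / 2 ^ i)⌋₊ (2 ^ i - 1),
    lt_of_le_of_lt (min_le_right _ _) (Nat.sub_lt (Nat.two_pow_pos i) Nat.one_pos)⟩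

/-- The number of grids used: `log₂ (2Δd/ε)`, rounded up (and `0` if this is negative). -/
noncomputable def numScales (d : ℕ) (Δ ε : ℝ) : ℕ := ⌈Real.logb 2 (2 * Δ * d / ε)⌉₊

/-- The algorithm EMD-Closeness-Tester: for `i = 1, …, numScales`, run the `ℓ₁` tester on the
`i`-coarsenings, with fresh samples; reject if one of these runs rejects, otherwise accept. -/
noncomputable def emdClosenessTester (T : L1Subroutine) (d : ℕ) (Δ ε : ℝ) :
    SampleAlg (L1Space d) Bool :=
  SampleAlg.allAccept <| (List.range' 1 (numScales d Δ ε)).map fun i : ℕ =>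
    (T (GridCell d i)
      (ε * (2 : ℝ) ^ ((i : ℤ) - 2) / (Δ * d * numScales d Δ ε))
      (1 / (3 * numScales d Δ ε))).comap (gridCell Δ i)

/-!
*Correctness.* Transport greedily, from the finest grid to the coarsest: inside each cell of the
`i`-th grid, move as much of the remaining mass as possible. After level `i` the mass still to be
moved is half the `ℓ₁` distance of the `i`-coarsenings, and each unit moved at level `i` travels at
most `Δ * d / 2 ^ i`. Summation by parts bounds the Earth Mover's Distance by
`Δ * d / 2 ^ L + ∑ i ∈ {1, …, L}, Δ * d / 2 ^ i * ‖p⁽ⁱ⁾ - q⁽ⁱ⁾‖₁ / 2`, so a large distance shows up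
at some scale.

*Sample complexity.* On a domain of size `n`, spend about `n ^ (2 / 3)` samples on the weights
`w x = 1 / (1 + number of occurrences of x)`; these make the expectation of
`∑ x, (w x * (p x + q x)) ^ 2` small. If `A` and `B` are independent differences of the counts of
`m` samples from `p` and `m` samples from `q`, then `∑ x, w x * A x * B x` has mean
`m ^ 2 * ∑ x, w x * (p x - q x) ^ 2`, and only second moments of counts enter its variance, so
Chebyshev's inequality yields an `ℓ₁`-closeness tester with `O(n ^ (2 / 3) / (ε ^ 2 * δ))` samples.
At scale `i` this costs `2 ^ (2 * d * i / 3) * 4 ^ (L - i)` up to powers of `L`, which is at most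
`(2 ^ L) ^ max 2 (2 * d / 3)`.
-/

namespace SampleAlg

variable {X Y α β : Type}

theorem run_bind (f : α → SampleAlg X β) (A : SampleAlg X α) (p q : PMF X) :
    (A.bind f).run p q = (A.run p q).bind fun a => (f a).run p q := by
  induction A with
  | ret a => simp [bind, run]
  | drawP k ih => simp [bind, run, ih]
  | drawQ k ih => simp [bind, run, ih]
  | rand μ k ih => simp [bind, run, ih]

section AcceptProb

variable (A : SampleAlg X Bool) (p q : PMF X)

theorem acceptProb_add_rejectProb : A.acceptProb p q + A.rejectProb p q = 1 := by
  rw [acceptProb, rejectProb, ← ENNReal.toReal_add ((A.run p q).apply_ne_top _)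
    ((A.run p q).apply_ne_top _), add_comm, ← tsum_bool, (A.run p q).tsum_coe, ENNReal.toReal_one]

theorem acceptProb_nonneg : 0 ≤ A.acceptProb p q := ENNReal.toReal_nonneg

theorem rejectProb_nonneg : 0 ≤ A.rejectProb p q := ENNReal.toReal_nonneg

theorem acceptProb_le_one : A.acceptProb p q ≤ 1 := by
  linarith [A.acceptProb_add_rejectProb p q, A.rejectProb_nonneg p q]

theorem acceptProb_comap (g : X → Y) (A : SampleAlg Y Bool) :
    (A.comap g).acceptProb p q = A.acceptProb (p.map g) (q.map g) := by
  rw [acceptProb, acceptProb, run_comap]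

theorem rejectProb_comap (g : X → Y) (A : SampleAlg Y Bool) :
    (A.comap g).rejectProb p q = A.rejectProb (p.map g) (q.map g) := by
  rw [rejectProb, rejectProb, run_comap]

theorem acceptProb_allAccept_cons (As : List (SampleAlg X Bool)) :
    (allAccept (A :: As)).acceptProb p q =
      A.acceptProb p q * (allAccept As).acceptProb p q := by
  simp [allAccept, acceptProb, run_bind, PMF.bind_apply, run]

theorem rejectProb_allAccept_le_sum (l : List (SampleAlg X Bool)) :
    (allAccept l).rejectProb p q ≤ (l.map fun A => A.rejectProb p q).sum := by
  induction l with
  | nil => simp [allAccept, rejectProb, run]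
  | cons A As ih =>
    have hcons := acceptProb_allAccept_cons A p q As
    have hA := A.acceptProb_add_rejectProb p q
    have hAs := (allAccept As).acceptProb_add_rejectProb p q
    have hall := (allAccept (A :: As)).acceptProb_add_rejectProb p q
    have hmul := mul_nonneg (A.rejectProb_nonneg p q) ((allAccept As).rejectProb_nonneg p q)
    rw [hcons, eq_sub_of_add_eq hA, eq_sub_of_add_eq hAs] at hall
    rw [List.map_cons, List.sum_cons]
    linarith

variable {A} in
theorem rejectProb_le_rejectProb_allAccept {l : List (SampleAlg X Bool)} (hA : A ∈ l) :
    A.rejectProb p q ≤ (allAccept l).rejectProb p q := by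
  suffices h : (allAccept l).acceptProb p q ≤ A.acceptProb p q by
    linarith [A.acceptProb_add_rejectProb p q, (allAccept l).acceptProb_add_rejectProb p q]
  induction l with
  | nil => simp at hA
  | cons B Bs ih =>
    rw [acceptProb_allAccept_cons]
    rcases List.mem_cons.1 hA with rfl | hA
    · exact mul_le_of_le_one_right (acceptProb_nonneg _ _ _) (acceptProb_le_one _ _ _)
    · exact (mul_le_of_le_one_left (acceptProb_nonneg _ _ _) (acceptProb_le_one _ _ _)).trans
        (ih hA)

end AcceptProb

theorem samples_bind_le (f : α → SampleAlg X β) (A : SampleAlg X α) {c : ℕ∞}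
    (hf : ∀ a, (f a).samples ≤ c) : (A.bind f).samples ≤ A.samples + c := by
  induction A with
  | ret a => simpa [bind, samples] using hf a
  | drawP k ih | drawQ k ih =>
    simp only [bind, samples, add_assoc]
    gcongr
    exact iSup_le fun x => (ih x).trans (by gcongr; exact le_iSup (fun x => (k x).samples) x)
  | rand _ k ih =>
    exact iSup_le fun n => (ih n).trans (by gcongr; exact le_iSup (fun n => (k n).samples) n)

theorem samples_comap_le (g : X → Y) (A : SampleAlg Y α) : (A.comap g).samples ≤ A.samples := by
  induction A with
  | ret a => exact le_rfl
  | drawP k ih | drawQ k ih =>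
    exact add_le_add_right (iSup_le fun x => le_iSup_of_le (g x) (ih (g x))) 1
  | rand _ k ih => exact iSup_mono ih

theorem samples_allAccept_le_sum (l : List (SampleAlg X Bool)) :
    (allAccept l).samples ≤ (l.map samples).sum := by
  induction l with
  | nil => simp [allAccept, samples]
  | cons A As ih =>
    rw [List.map_cons, List.sum_cons]
    refine samples_bind_le _ _ fun b => ?_
    cases b
    · simp [samples]
    · simpa using ih

theorem samples_allAccept_le_floor {l : List (SampleAlg X Bool)} {b : ℝ} (hb : 0 ≤ b)
    (hl : ∀ A ∈ l, A.samples ≤ (⌊b⌋₊ : ℕ∞)) :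
    (allAccept l).samples ≤ (⌊l.length * b⌋₊ : ℕ∞) :=
  calc (allAccept l).samples
      ≤ (l.map samples).sum := samples_allAccept_le_sum l
    _ ≤ (l.map samples).length • (⌊b⌋₊ : ℕ∞) := List.sum_le_card_nsmul _ _ (by simpa using hl)
    _ = ((l.length * ⌊b⌋₊ : ℕ) : ℕ∞) := by simp
    _ ≤ (⌊l.length * b⌋₊ : ℕ∞) := by
        refine Nat.cast_le.2 (Nat.le_floor ?_)
        push_cast
        gcongr
        exact Nat.floor_le hb

section DrawCounts

variable [DecidableEq X] {draw : (X → SampleAlg X α) → SampleAlg X α}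

/-- Draw `k` samples by means of `draw`, which stands for `drawP` or `drawQ`, and continue with the
number of occurrences of each value. -/
def drawCounts (draw : (X → SampleAlg X α) → SampleAlg X α) :
    ℕ → ((X → ℕ) → SampleAlg X α) → SampleAlg X α
  | 0, f => f 0
  | k + 1, f => draw fun x => drawCounts draw k fun N => f (N + Pi.single x 1)

/-- Draw `m` samples from each of the two distributions and continue with the difference of the
numbers of occurrences of each value. -/
noncomputable def drawDiff (m : ℕ) (f : (X → ℝ) → SampleAlg X α) : SampleAlg X α :=
  drawCounts drawP m fun N => drawCounts drawQ m fun N' => f fun x => N x - N' x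

theorem samples_drawCounts_le
    (hdraw : ∀ (g : X → SampleAlg X α) (c : ℕ∞),
      (∀ x, (g x).samples ≤ c) → (draw g).samples ≤ 1 + c)
    (k : ℕ) {f : (X → ℕ) → SampleAlg X α} {c : ℕ∞} (hf : ∀ N, (f N).samples ≤ c) :
    (drawCounts draw k f).samples ≤ k + c := by
  induction k generalizing f with
  | zero => simpa [drawCounts] using hf 0
  | succ k ih =>
    rw [Nat.cast_add, Nat.cast_one, add_comm (k : ℕ∞), add_assoc]
    exact hdraw _ _ fun x => ih fun N => hf _

theorem samples_drawCounts_drawP_le (k : ℕ) {f : (X → ℕ) → SampleAlg X α} {c : ℕ∞}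
    (hf : ∀ N, (f N).samples ≤ c) : (drawCounts drawP k f).samples ≤ k + c :=
  samples_drawCounts_le (draw := drawP) (fun _ _ h => add_le_add_right (iSup_le h) 1) k hf

theorem samples_drawCounts_drawQ_le (k : ℕ) {f : (X → ℕ) → SampleAlg X α} {c : ℕ∞}
    (hf : ∀ N, (f N).samples ≤ c) : (drawCounts drawQ k f).samples ≤ k + c :=
  samples_drawCounts_le (draw := drawQ) (fun _ _ h => add_le_add_right (iSup_le h) 1) k hf

theorem samples_drawDiff_le (m : ℕ) {f : (X → ℝ) → SampleAlg X α} {c : ℕ∞}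
    (hf : ∀ A, (f A).samples ≤ c) : (drawDiff m f).samples ≤ m + (m + c) :=
  samples_drawCounts_drawP_le m fun _ => samples_drawCounts_drawQ_le m fun _ => hf _

end DrawCounts

end SampleAlg

/-! ### Expectations over the counts of independent samples -/

section CountExp

variable {X : Type*} [Fintype X] [DecidableEq X]

/-- The expectation of a function of the numbers of occurrences of the elements of `X` among
`k` independent samples of law `P`. -/
noncomputable def countExp (P : X → ℝ) : ℕ → (((X → ℕ) → ℝ) →ₗ[ℝ] ℝ)
  | 0 => LinearMap.proj 0
  | k + 1 => ∑ x, P x • (countExp P k ∘ₗ LinearMap.funLeft ℝ ℝ fun N => N + Pi.single x 1)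

theorem countExp_zero (P : X → ℝ) (F : (X → ℕ) → ℝ) : countExp P 0 F = F 0 := rfl

theorem countExp_succ (P : X → ℝ) (k : ℕ) (F : (X → ℕ) → ℝ) :
    countExp P (k + 1) F = ∑ x, P x * countExp P k fun N => F (N + Pi.single x 1) := by
  simp only [countExp, LinearMap.sum_apply, LinearMap.smul_apply, LinearMap.comp_apply, smul_eq_mul]
  rfl

theorem countExp_add (P : X → ℝ) (k : ℕ) (F G : (X → ℕ) → ℝ) :
    (countExp P k fun N => F N + G N) = countExp P k F + countExp P k G :=
  map_add (countExp P k) F G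

theorem countExp_const_mul (P : X → ℝ) (k : ℕ) (c : ℝ) (F : (X → ℕ) → ℝ) :
    (countExp P k fun N => c * F N) = c * countExp P k F :=
  map_smul (countExp P k) c F

theorem countExp_sum {ι : Type*} (s : Finset ι) (P : X → ℝ) (k : ℕ) (F : ι → (X → ℕ) → ℝ) :
    (countExp P k fun N => ∑ i ∈ s, F i N) = ∑ i ∈ s, countExp P k (F i) := by
  rw [← map_sum, Finset.sum_fn]

theorem countExp_const {P : X → ℝ} (hP : ∑ x, P x = 1) (k : ℕ) (c : ℝ) :
    (countExp P k fun _ => c) = c := by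
  induction k with
  | zero => rfl
  | succ k ih => simp only [countExp_succ, ih, ← Finset.sum_mul, hP, one_mul]

theorem countExp_mono {P : X → ℝ} (hP : ∀ x, 0 ≤ P x) (k : ℕ) {F G : (X → ℕ) → ℝ}
    (h : ∀ N, ∑ x, N x = k → F N ≤ G N) : countExp P k F ≤ countExp P k G := by
  induction k generalizing F G with
  | zero => exact h 0 (by simp)
  | succ k ih =>
    simp only [countExp_succ]
    refine Finset.sum_le_sum fun x _ => mul_le_mul_of_nonneg_left (ih fun N hN => h _ ?_) (hP x)
    simp [Finset.sum_add_distrib, hN]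

theorem countExp_succ_apply_mul (P : X → ℝ) (k : ℕ) (x : X) (F : (X → ℕ) → ℝ) :
    (countExp P (k + 1) fun N => N x * F N) =
      (∑ y, P y * countExp P k fun N => N x * F (N + Pi.single y 1)) +
        P x * countExp P k fun N => F (N + Pi.single x 1) := by
  have hsplit (y : X) : P y * (countExp P k fun N =>
      (((N + Pi.single y 1 : X → ℕ) x : ℕ) : ℝ) * F (N + Pi.single y 1)) =
      (P y * countExp P k fun N => N x * F (N + Pi.single y 1)) +
        if x = y then P y * (countExp P k fun N => F (N + Pi.single y 1)) else 0 := by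
    simp only [Pi.add_apply, Nat.cast_add, add_mul, countExp_add, countExp_const_mul, mul_add,
      Pi.single_apply]
    split_ifs <;> simp
  rw [countExp_succ, Finset.sum_congr rfl fun y _ => hsplit y, Finset.sum_add_distrib,
    Finset.sum_ite_eq, if_pos (Finset.mem_univ x)]

/-- Size-biasing: weighting by the number of occurrences of `x` amounts to adding one sample at
`x`. -/
theorem countExp_apply_mul (P : X → ℝ) (k : ℕ) (x : X) (F : (X → ℕ) → ℝ) :
    (countExp P (k + 1) fun N => N x * F N) =
      (k + 1) * P x * countExp P k fun N => F (N + Pi.single x 1) := by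
  induction k generalizing F with
  | zero => simp [countExp_succ_apply_mul, countExp_zero]
  | succ k ih =>
    have hsum : ∑ y, P y * ((k + 1) * P x *
        countExp P k fun N => F (N + Pi.single x 1 + Pi.single y 1)) =
        (k + 1) * P x * countExp P (k + 1) fun N => F (N + Pi.single x 1) := by
      rw [countExp_succ, Finset.mul_sum]
      refine Finset.sum_congr rfl fun y _ => ?_
      simp only [add_right_comm _ (Pi.single x 1)]
      ring
    rw [countExp_succ_apply_mul, Finset.sum_congr rfl fun y _ => by rw [ih], hsum]
    push_cast
    ring

theorem mul_countExp_inv_le {P : X → ℝ} (hP : P ∈ stdSimplex ℝ X) (k : ℕ) (x : X) :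
    P x * (countExp P k fun N => ((N x : ℝ) + 1)⁻¹) ≤ 1 / (k + 1) := by
  rw [le_div_iff₀ (by positivity)]
  calc P x * (countExp P k fun N => ((N x : ℝ) + 1)⁻¹) * (k + 1)
      = countExp P (k + 1) fun N => N x * (N x : ℝ)⁻¹ := by
        rw [countExp_apply_mul P k x fun N => (N x : ℝ)⁻¹]
        simp only [Pi.add_apply, Pi.single_eq_same, Nat.cast_add, Nat.cast_one]
        ring
    _ ≤ countExp P (k + 1) fun _ => 1 := countExp_mono hP.1 _ fun N _ => mul_inv_le_one
    _ = 1 := countExp_const hP.2 _ _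

theorem countExp_sq {P : X → ℝ} (hP : ∑ x, P x = 1) (k : ℕ) (u : X → ℝ) (c : ℝ) :
    (countExp P k fun N => (∑ x, u x * N x + c) ^ 2) =
      k * (∑ x, u x ^ 2 * P x - (∑ x, u x * P x) ^ 2) + (k * ∑ x, u x * P x + c) ^ 2 := by
  induction k generalizing c with
  | zero => simp [countExp_zero]
  | succ k ih =>
    set V := ∑ x, u x ^ 2 * P x with hV
    set μ := ∑ x, u x * P x with hμ
    have hstep (y : X) :
        (countExp P k fun N => (∑ x, u x * ((N + Pi.single y 1 : X → ℕ) x : ℕ) + c) ^ 2) =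
          k * (V - μ ^ 2) + (k * μ + (u y + c)) ^ 2 := by
      rw [← ih]
      simp [mul_add, Finset.sum_add_distrib, Pi.single_apply, add_assoc]
    have hexpand (y : X) : P y * (k * (V - μ ^ 2) + (k * μ + (u y + c)) ^ 2) =
        u y ^ 2 * P y + 2 * (k * μ + c) * (u y * P y) +
          (k * (V - μ ^ 2) + (k * μ + c) ^ 2) * P y := by ring
    simp only [countExp_succ, hstep, hexpand, Finset.sum_add_distrib, ← Finset.mul_sum, hP, ← hV,
      ← hμ]
    push_cast
    ring

end CountExp

theorem sum_mul_le_sqrt_sum_sq_mul_sum {ι : Type*} (s : Finset ι) (f : ι → ℝ) {g : ι → ℝ}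
    (hg : ∀ i ∈ s, 0 ≤ g i) : ∑ i ∈ s, f i * g i ≤ √(∑ i ∈ s, f i ^ 2) * ∑ i ∈ s, g i := by
  rw [Finset.mul_sum]
  refine Finset.sum_le_sum fun i hi => mul_le_mul_of_nonneg_right ?_ (hg i hi)
  exact Real.le_sqrt_of_sq_le <|
    Finset.single_le_sum (f := fun i => f i ^ 2) (fun i _ => sq_nonneg _) hi

section CorrExp

variable {X : Type*} [Fintype X] [DecidableEq X] {P Q : X → ℝ}

/-- The expectation of a function of the difference of the counts of `m` samples of law `P` and
`m` samples of law `Q`. -/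
noncomputable def diffExp (P Q : X → ℝ) (m : ℕ) (F : (X → ℝ) → ℝ) : ℝ :=
  countExp P m fun N => countExp Q m fun N' => F fun x => N x - N' x

/-- The expectation of a function of the correlation `∑ x, w x * A x * B x` of two independent
differences `A`, `B` of counts as in `diffExp`. -/
noncomputable def corrExp (P Q : X → ℝ) (m : ℕ) (w : X → ℝ) (F : ℝ → ℝ) : ℝ :=
  diffExp P Q m fun A => diffExp P Q m fun B => F (∑ x, w x * A x * B x)

theorem diffExp_mono (hP : ∀ x, 0 ≤ P x) (hQ : ∀ x, 0 ≤ Q x) (m : ℕ) {F G : (X → ℝ) → ℝ}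
    (h : ∀ A, F A ≤ G A) : diffExp P Q m F ≤ diffExp P Q m G :=
  countExp_mono hP m fun _ _ => countExp_mono hQ m fun _ _ => h _

theorem diffExp_add (P Q : X → ℝ) (m : ℕ) (F G : (X → ℝ) → ℝ) :
    (diffExp P Q m fun A => F A + G A) = diffExp P Q m F + diffExp P Q m G := by
  simp only [diffExp, countExp_add]

theorem diffExp_const_mul (P Q : X → ℝ) (m : ℕ) (c : ℝ) (F : (X → ℝ) → ℝ) :
    (diffExp P Q m fun A => c * F A) = c * diffExp P Q m F := by
  simp only [diffExp, countExp_const_mul]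

theorem diffExp_sum {ι : Type*} (s : Finset ι) (P Q : X → ℝ) (m : ℕ) (F : ι → (X → ℝ) → ℝ) :
    (diffExp P Q m fun A => ∑ i ∈ s, F i A) = ∑ i ∈ s, diffExp P Q m (F i) := by
  simp only [diffExp, countExp_sum]

theorem diffExp_sq_le (hP : ∑ x, P x = 1) (hQ : ∑ x, Q x = 1) (m : ℕ) (u : X → ℝ) (c : ℝ) :
    (diffExp P Q m fun A => (∑ x, u x * A x + c) ^ 2) ≤
      m * ∑ x, u x ^ 2 * (P x + Q x) + (m * ∑ x, u x * (P x - Q x) + c) ^ 2 := by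
  have hinner (N : X → ℕ) : (countExp Q m fun N' => (∑ x, u x * ((N x : ℝ) - N' x) + c) ^ 2) =
      (∑ x, u x * N x + (c - m * ∑ x, u x * Q x)) ^ 2 +
        m * (∑ x, u x ^ 2 * Q x - (∑ x, u x * Q x) ^ 2) := by
    have h := countExp_sq hQ m (fun x => -u x) (∑ x, u x * N x + c)
    simp only [neg_sq, neg_mul, Finset.sum_neg_distrib, mul_neg] at h
    refine Eq.trans ?_ (h.trans (by ring))
    congr 1
    ext N'
    simp only [mul_sub, Finset.sum_sub_distrib]
    ring
  simp only [diffExp, hinner, countExp_add, countExp_const hP, countExp_sq hP]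
  simp only [mul_add, mul_sub, Finset.sum_add_distrib, Finset.sum_sub_distrib, sub_add_eq_add_sub,
    add_sub_assoc]
  linarith [mul_nonneg m.cast_nonneg (sq_nonneg (∑ x, u x * P x)),
    mul_nonneg m.cast_nonneg (sq_nonneg (∑ x, u x * Q x))]

theorem diffExp_apply_sq_le (hP : ∑ x, P x = 1) (hQ : ∑ x, Q x = 1) (m : ℕ) (x : X) :
    (diffExp P Q m fun A => A x ^ 2) ≤ m * (P x + Q x) + (m * (P x - Q x)) ^ 2 := by
  simpa [Pi.single_apply] using diffExp_sq_le hP hQ m (Pi.single x 1) 0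

theorem diffExp_correlation_sq_le (hP : ∑ x, P x = 1) (hQ : ∑ x, Q x = 1) (m : ℕ)
    (w A : X → ℝ) (s : ℝ) :
    (diffExp P Q m fun B => (∑ x, w x * A x * B x - m ^ 2 * s) ^ 2) ≤
      ∑ x, m * (w x ^ 2 * (P x + Q x)) * A x ^ 2 +
        m ^ 2 * (∑ x, w x * (P x - Q x) * A x + -(m * s)) ^ 2 := by
  refine (diffExp_sq_le hP hQ m (fun x => w x * A x) (-(m ^ 2 * s))).trans_eq ?_
  simp only [mul_right_comm (w _) (A _), Finset.mul_sum]
  congr 1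
  · exact Finset.sum_congr rfl fun x _ => by ring
  · rw [← Finset.mul_sum]
    ring

theorem corrExp_sq_sub_le (hP : P ∈ stdSimplex ℝ X) (hQ : Q ∈ stdSimplex ℝ X) (m : ℕ)
    (w : X → ℝ) :
    corrExp P Q m w (fun z => (z - m ^ 2 * ∑ x, w x * (P x - Q x) ^ 2) ^ 2) ≤
      m ^ 2 * ∑ x, w x ^ 2 * (P x + Q x) ^ 2 +
        2 * m ^ 3 * ∑ x, w x ^ 2 * (P x + Q x) * (P x - Q x) ^ 2 := by
  set s := ∑ x, w x * (P x - Q x) ^ 2 with hs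
  have hmean : (diffExp P Q m fun A => (∑ x, w x * (P x - Q x) * A x + -(m * s)) ^ 2) ≤
      m * ∑ x, (w x * (P x - Q x)) ^ 2 * (P x + Q x) := by
    refine (diffExp_sq_le hP.2 hQ.2 m _ _).trans_eq ?_
    simp only [mul_assoc, ← sq, ← hs, add_neg_cancel, ne_eq, OfNat.ofNat_ne_zero, not_false_eq_true,
      zero_pow, add_zero]
  have hcoeff (x : X) : 0 ≤ m * (w x ^ 2 * (P x + Q x)) :=
    mul_nonneg m.cast_nonneg <| mul_nonneg (sq_nonneg _) <| add_nonneg (hP.1 x) (hQ.1 x)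
  calc corrExp P Q m w (fun z => (z - m ^ 2 * s) ^ 2)
      ≤ diffExp P Q m fun A => ∑ x, m * (w x ^ 2 * (P x + Q x)) * A x ^ 2 +
          m ^ 2 * (∑ x, w x * (P x - Q x) * A x + -(m * s)) ^ 2 :=
        diffExp_mono hP.1 hQ.1 m fun A => diffExp_correlation_sq_le hP.2 hQ.2 m w A s
    _ = ∑ x, m * (w x ^ 2 * (P x + Q x)) * (diffExp P Q m fun A => A x ^ 2) +
          m ^ 2 * diffExp P Q m fun A => (∑ x, w x * (P x - Q x) * A x + -(m * s)) ^ 2 := by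
        simp only [diffExp_add, diffExp_sum, diffExp_const_mul]
    _ ≤ ∑ x, m * (w x ^ 2 * (P x + Q x)) * (m * (P x + Q x) + (m * (P x - Q x)) ^ 2) +
          m ^ 2 * (m * ∑ x, (w x * (P x - Q x)) ^ 2 * (P x + Q x)) := by
        gcongr with x
        · exact hcoeff x
        · exact diffExp_apply_sq_le hP.2 hQ.2 m x
    _ = _ := by
        simp only [Finset.mul_sum, ← Finset.sum_add_distrib]
        exact Finset.sum_congr rfl fun x _ => by ring

theorem corrExp_indicator_le (hP : ∀ x, 0 ≤ P x) (hQ : ∀ x, 0 ≤ Q x) (m : ℕ) (w : X → ℝ)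
    {S : Set ℝ} {a c : ℝ} (ha : 0 < a) (hS : ∀ z ∈ S, a ≤ |z - c|) :
    corrExp P Q m w (S.indicator 1) ≤ corrExp P Q m w (fun z => (z - c) ^ 2) / a ^ 2 := by
  have hcheb (z : ℝ) : S.indicator 1 z ≤ (a ^ 2)⁻¹ * (z - c) ^ 2 := by
    refine Set.indicator_apply_le' (fun hz => ?_) fun _ => by positivity
    rw [Pi.one_apply, ← div_eq_inv_mul, one_le_div₀ (by positivity), ← sq_abs (z - c)]
    exact pow_le_pow_left₀ ha.le (hS z hz) 2
  rw [div_eq_inv_mul]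
  simp only [corrExp, ← diffExp_const_mul]
  exact diffExp_mono hP hQ m fun A => diffExp_mono hP hQ m fun B => hcheb _

theorem corrExp_Ici_le (hP : P ∈ stdSimplex ℝ X) (m : ℕ) (w : X → ℝ) {t : ℝ} (ht : 0 < t) :
    corrExp P P m w ((Set.Ici t).indicator 1) ≤
      m ^ 2 / t ^ 2 * ∑ x, w x ^ 2 * (P x + P x) ^ 2 := by
  have hvar := corrExp_sq_sub_le hP hP m w
  simp only [sub_self, ne_eq, OfNat.ofNat_ne_zero, not_false_eq_true, zero_pow, mul_zero,
    Finset.sum_const_zero, add_zero] at hvar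
  calc corrExp P P m w ((Set.Ici t).indicator 1)
      ≤ corrExp P P m w (fun z => (z - 0) ^ 2) / t ^ 2 :=
        corrExp_indicator_le hP.1 hP.1 m w ht fun z hz => by
          rw [sub_zero]
          exact hz.trans (le_abs_self z)
    _ ≤ (m ^ 2 * ∑ x, w x ^ 2 * (P x + P x) ^ 2) / t ^ 2 := by gcongr
    _ = _ := by ring

theorem corrExp_sq_sub_le_of_nonneg (hP : P ∈ stdSimplex ℝ X) (hQ : Q ∈ stdSimplex ℝ X) (m : ℕ)
    {w : X → ℝ} (hw : ∀ x, 0 ≤ w x) {δ : ℝ} (hδ : 0 < δ) (hδ1 : δ ≤ 1) :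
    corrExp P Q m w (fun z => (z - m ^ 2 * ∑ x, w x * (P x - Q x) ^ 2) ^ 2) ≤
      9 / δ * m ^ 2 * ∑ x, w x ^ 2 * (P x + Q x) ^ 2 +
        δ / 8 * (m ^ 2 * ∑ x, w x * (P x - Q x) ^ 2) ^ 2 := by
  refine (corrExp_sq_sub_le hP hQ m w).trans ?_
  set s := ∑ x, w x * (P x - Q x) ^ 2
  set b := ∑ x, w x ^ 2 * (P x + Q x) ^ 2
  have hb : √b ^ 2 = b := Real.sq_sqrt (Finset.sum_nonneg fun x _ => by positivity)
  have hcross : ∑ x, w x ^ 2 * (P x + Q x) * (P x - Q x) ^ 2 ≤ √b * s := by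
    have h := sum_mul_le_sqrt_sum_sq_mul_sum Finset.univ (fun x => w x * (P x + Q x))
      fun x _ => mul_nonneg (hw x) (sq_nonneg (P x - Q x))
    simp only [mul_pow] at h
    exact (Finset.sum_congr rfl fun x _ => by ring).trans_le h
  have hamgm : 2 * m ^ 3 * (√b * s) ≤ 8 / δ * m ^ 2 * b + δ / 8 * (m ^ 2 * s) ^ 2 := by
    have hsq : 0 ≤ 8 / δ * (m * √b - δ / 8 * (m ^ 2 * s)) ^ 2 := by positivity
    have hexpand : 8 / δ * (m * √b - δ / 8 * (m ^ 2 * s)) ^ 2 =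
        8 / δ * m ^ 2 * √b ^ 2 + δ / 8 * (m ^ 2 * s) ^ 2 - 2 * m ^ 3 * (√b * s) := by
      field_simp
      ring
    rw [hb] at hexpand
    linarith
  calc m ^ 2 * b + 2 * m ^ 3 * ∑ x, w x ^ 2 * (P x + Q x) * (P x - Q x) ^ 2
      ≤ 1 / δ * m ^ 2 * b + (8 / δ * m ^ 2 * b + δ / 8 * (m ^ 2 * s) ^ 2) := by
        refine add_le_add ?_ (le_trans (by gcongr) hamgm)
        rw [← hb, mul_assoc]
        exact le_mul_of_one_le_left (by positivity) ((one_le_div₀ hδ).2 hδ1)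
    _ = 9 / δ * m ^ 2 * b + δ / 8 * (m ^ 2 * s) ^ 2 := by ring

theorem corrExp_Iio_le (hP : P ∈ stdSimplex ℝ X) (hQ : Q ∈ stdSimplex ℝ X) {m : ℕ} (hm : 0 < m)
    {w : X → ℝ} (hw : ∀ x, 0 ≤ w x) {s₀ δ : ℝ} (hs₀ : 0 < s₀) (hδ : 0 < δ) (hδ1 : δ ≤ 1)
    (hs : s₀ ≤ ∑ x, w x * (P x - Q x) ^ 2) :
    corrExp P Q m w ((Set.Iio (m ^ 2 * s₀ / 2)).indicator 1) ≤
      δ / 2 + 36 / (δ * m ^ 2 * s₀ ^ 2) * ∑ x, w x ^ 2 * (P x + Q x) ^ 2 := by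
  have hvar := corrExp_sq_sub_le_of_nonneg hP hQ m hw hδ hδ1
  set s := ∑ x, w x * (P x - Q x) ^ 2
  set b := ∑ x, w x ^ 2 * (P x + Q x) ^ 2
  have hs_pos : 0 < s := hs₀.trans_le hs
  have hfar : ∀ z ∈ Set.Iio (m ^ 2 * s₀ / 2), m ^ 2 * s / 2 ≤ |z - m ^ 2 * s| := by
    intro z hz
    rw [Set.mem_Iio] at hz
    have hms : (m : ℝ) ^ 2 * s₀ ≤ m ^ 2 * s := by gcongr
    rw [abs_sub_comm]
    exact le_trans (by linarith) (le_abs_self _)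
  calc corrExp P Q m w ((Set.Iio (m ^ 2 * s₀ / 2)).indicator 1)
      ≤ corrExp P Q m w (fun z => (z - m ^ 2 * s) ^ 2) / (m ^ 2 * s / 2) ^ 2 :=
        corrExp_indicator_le hP.1 hQ.1 m w (by positivity) hfar
    _ ≤ (9 / δ * m ^ 2 * b + δ / 8 * (m ^ 2 * s) ^ 2) / (m ^ 2 * s / 2) ^ 2 := by gcongr
    _ = δ / 2 + 36 / (δ * m ^ 2 * s ^ 2) * b := by
        field_simp
        ring
    _ ≤ δ / 2 + 36 / (δ * m ^ 2 * s₀ ^ 2) * b := by gcongr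

end CorrExp

/-! ### A closeness tester for the `ℓ₁` distance -/

theorem toReal_pmf_mem_stdSimplex {X : Type*} [Fintype X] (p : PMF X) :
    (fun x => (p x).toReal) ∈ stdSimplex ℝ X := by
  refine ⟨fun x => ENNReal.toReal_nonneg, ?_⟩
  rw [← ENNReal.toReal_sum fun x _ => p.apply_ne_top x, ← tsum_fintype (L := .unconditional X),
    p.tsum_coe, ENNReal.toReal_one]

theorem toReal_pmf_bind_apply {X Y : Type*} [Fintype X] (p : PMF X) (f : X → PMF Y) (y : Y) :
    (p.bind f y).toReal = ∑ x, (p x).toReal * (f x y).toReal := by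
  rw [PMF.bind_apply, tsum_fintype, ENNReal.toReal_sum
    fun x _ => ENNReal.mul_ne_top (p.apply_ne_top _) (PMF.apply_ne_top _ _)]
  simp only [ENNReal.toReal_mul]

section FlatWeight

variable {X : Type*}

/-- The weight that flattening gives to `x`, when `N` and `N'` count the samples spent on it from
the two distributions. The `1` stands for the element `x` itself. -/
noncomputable def flatWeight (N N' : X → ℕ) (x : X) : ℝ := (N x + N' x + 1 : ℝ)⁻¹

theorem flatWeight_nonneg (N N' : X → ℕ) (x : X) : 0 ≤ flatWeight N N' x := by
  unfold flatWeight
  positivity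

/-- On a domain of size `n`, with `k` samples of each distribution spent on the weights, a lower
bound for the weighted squared `ℓ₂` distance of distributions whose `ℓ₁` distance is at least
`ε`. -/
noncomputable def flatSep (n k : ℕ) (ε : ℝ) : ℝ := ε ^ 2 / (n + 2 * k)

theorem flatSep_pos {n : ℕ} (hn : 0 < n) (k : ℕ) {ε : ℝ} (hε : 0 < ε) : 0 < flatSep n k ε := by
  unfold flatSep
  positivity

theorem flatSep_le_sum_flatWeight_mul_sq [Fintype X] {k : ℕ} {N N' : X → ℕ} (hN : ∑ x, N x = k)
    (hN' : ∑ x, N' x = k) {ε : ℝ} (hε : 0 ≤ ε) {v : X → ℝ} (hv : ε ≤ ∑ x, |v x|) :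
    flatSep (Fintype.card X) k ε ≤ ∑ x, flatWeight N N' x * v x ^ 2 := by
  have hsum : ∑ x, (N x + N' x + 1 : ℝ) = Fintype.card X + 2 * k := by
    rw [Finset.sum_add_distrib, Finset.sum_add_distrib]
    norm_cast
    simp only [hN, hN', Finset.sum_const, Finset.card_univ, smul_eq_mul, mul_one]
    ring
  calc flatSep (Fintype.card X) k ε
      ≤ (∑ x, |v x|) ^ 2 / ∑ x, (N x + N' x + 1 : ℝ) := by
        rw [hsum, flatSep]
        gcongr
    _ ≤ ∑ x, |v x| ^ 2 / (N x + N' x + 1 : ℝ) :=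
        Finset.sq_sum_div_le_sum_sq_div _ _ fun x _ => by positivity
    _ = ∑ x, flatWeight N N' x * v x ^ 2 :=
        Finset.sum_congr rfl fun x _ => by rw [sq_abs, div_eq_inv_mul, flatWeight]

theorem flatWeight_sq_mul_add_sq_le (N N' : X → ℕ) (x : X) (a b : ℝ) :
    flatWeight N N' x ^ 2 * (a + b) ^ 2 ≤
      2 * a ^ 2 * ((N x : ℝ) + 1)⁻¹ + 2 * b ^ 2 * ((N' x : ℝ) + 1)⁻¹ := by
  have hN : (0 : ℝ) ≤ N x := Nat.cast_nonneg _
  have hN' : (0 : ℝ) ≤ N' x := Nat.cast_nonneg _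
  have hw0 := flatWeight_nonneg N N' x
  have hw1 : flatWeight N N' x ≤ 1 := inv_le_one_of_one_le₀ (by linarith [hN, hN'])
  have hwN : flatWeight N N' x ≤ ((N x : ℝ) + 1)⁻¹ := by
    unfold flatWeight
    gcongr
    linarith [hN']
  have hwN' : flatWeight N N' x ≤ ((N' x : ℝ) + 1)⁻¹ := by
    unfold flatWeight
    gcongr
    linarith [hN]
  calc flatWeight N N' x ^ 2 * (a + b) ^ 2
      ≤ flatWeight N N' x * (2 * (a ^ 2 + b ^ 2)) := by
        gcongr
        · exact pow_le_of_le_one hw0 hw1 two_ne_zero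
        · exact add_sq_le
    _ = 2 * a ^ 2 * flatWeight N N' x + 2 * b ^ 2 * flatWeight N N' x := by ring
    _ ≤ _ := by gcongr

variable [Fintype X] [DecidableEq X] {P Q : X → ℝ}

theorem sum_two_mul_sq_mul_countExp_inv_le (hP : P ∈ stdSimplex ℝ X) (k : ℕ) :
    ∑ x, 2 * P x ^ 2 * (countExp P k fun N => ((N x : ℝ) + 1)⁻¹) ≤ 2 / ((k : ℝ) + 1) :=
  calc ∑ x, 2 * P x ^ 2 * (countExp P k fun N => ((N x : ℝ) + 1)⁻¹)
      = ∑ x, 2 * P x * (P x * countExp P k fun N => ((N x : ℝ) + 1)⁻¹) :=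
        Finset.sum_congr rfl fun x _ => by ring
    _ ≤ ∑ x, 2 * P x * (1 / (k + 1)) := by
        gcongr with x
        · exact mul_nonneg zero_le_two (hP.1 x)
        · exact mul_countExp_inv_le hP k x
    _ = 2 / (k + 1) := by
        rw [← Finset.sum_mul, ← Finset.mul_sum, hP.2]
        ring

theorem countExp_sum_flatWeight_sq_le (hP : P ∈ stdSimplex ℝ X) (hQ : Q ∈ stdSimplex ℝ X)
    (k : ℕ) :
    (countExp P k fun N => countExp Q k fun N' =>
      ∑ x, flatWeight N N' x ^ 2 * (P x + Q x) ^ 2) ≤ 4 / (k + 1) :=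
  calc _ ≤ countExp P k fun N => countExp Q k fun N' => ∑ x, (2 * P x ^ 2 * ((N x : ℝ) + 1)⁻¹ +
          2 * Q x ^ 2 * ((N' x : ℝ) + 1)⁻¹) :=
        countExp_mono hP.1 k fun N _ => countExp_mono hQ.1 k fun N' _ =>
          Finset.sum_le_sum fun x _ => flatWeight_sq_mul_add_sq_le N N' x _ _
    _ = ∑ x, 2 * P x ^ 2 * (countExp P k fun N => ((N x : ℝ) + 1)⁻¹) +
          ∑ x, 2 * Q x ^ 2 * (countExp Q k fun N' => ((N' x : ℝ) + 1)⁻¹) := by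
        simp only [countExp_add, countExp_sum, countExp_const_mul, countExp_const hP.2,
          countExp_const hQ.2, Finset.sum_add_distrib]
    _ ≤ 2 / (k + 1) + 2 / (k + 1) :=
        add_le_add (sum_two_mul_sq_mul_countExp_inv_le hP k)
          (sum_two_mul_sq_mul_countExp_inv_le hQ k)
    _ = 4 / (k + 1) := by ring

end FlatWeight

namespace SampleAlg

section Run

variable {X α : Type} [Fintype X] [DecidableEq X] (p q : PMF X) (a : α)

variable {p q a} in
theorem toReal_run_drawCounts {draw : (X → SampleAlg X α) → SampleAlg X α} {P : X → ℝ}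
    (hdraw : ∀ g : X → SampleAlg X α,
      ((draw g).run p q a).toReal = ∑ x, P x * ((g x).run p q a).toReal)
    (k : ℕ) (f : (X → ℕ) → SampleAlg X α) :
    ((drawCounts draw k f).run p q a).toReal =
      countExp P k fun N => ((f N).run p q a).toReal := by
  induction k generalizing f with
  | zero => rfl
  | succ k ih => simp only [drawCounts, hdraw, ih, countExp_succ]

theorem toReal_run_drawCounts_drawP (k : ℕ) (f : (X → ℕ) → SampleAlg X α) :
    ((drawCounts drawP k f).run p q a).toReal =
      countExp (fun x => (p x).toReal) k fun N => ((f N).run p q a).toReal :=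
  toReal_run_drawCounts (fun _ => toReal_pmf_bind_apply _ _ _) k f

theorem toReal_run_drawCounts_drawQ (k : ℕ) (f : (X → ℕ) → SampleAlg X α) :
    ((drawCounts drawQ k f).run p q a).toReal =
      countExp (fun x => (q x).toReal) k fun N => ((f N).run p q a).toReal :=
  toReal_run_drawCounts (fun _ => toReal_pmf_bind_apply _ _ _) k f

theorem toReal_run_drawDiff (m : ℕ) (f : (X → ℝ) → SampleAlg X α) :
    ((drawDiff m f).run p q a).toReal =
      diffExp (fun x => (p x).toReal) (fun x => (q x).toReal) m
        fun A => ((f A).run p q a).toReal := by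
  simp only [drawDiff, toReal_run_drawCounts_drawP, toReal_run_drawCounts_drawQ, diffExp]

end Run

/-- The flattening test: `k` samples of each distribution determine the weights, and the weighted
correlation of two independent differences of counts, from `m` samples of each distribution, is
compared with the threshold `t`. -/
noncomputable def flatTest (X : Type) [Fintype X] [DecidableEq X] (k m : ℕ) (t : ℝ) :
    SampleAlg X Bool :=
  drawCounts drawP k fun N => drawCounts drawQ k fun N' => drawDiff m fun A => drawDiff m fun B =>
    ret (decide (∑ x, flatWeight N N' x * A x * B x < t))

section FlatTest

variable {X : Type} [Fintype X] [DecidableEq X]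

theorem samples_flatTest_le (k m : ℕ) (t : ℝ) :
    (flatTest X k m t).samples ≤ ((2 * k + 4 * m : ℕ) : ℕ∞) :=
  calc (flatTest X k m t).samples
      ≤ k + (k + (m + (m + (m + (m + (0 : ℕ∞)))))) :=
        samples_drawCounts_drawP_le k fun _ => samples_drawCounts_drawQ_le k fun _ =>
          samples_drawDiff_le m fun _ => samples_drawDiff_le m fun _ => le_rfl
    _ = ((2 * k + 4 * m : ℕ) : ℕ∞) := by
        norm_cast
        ring

theorem acceptProb_flatTest (k m : ℕ) (t : ℝ) (p q : PMF X) :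
    (flatTest X k m t).acceptProb p q =
      countExp (fun x => (p x).toReal) k fun N => countExp (fun x => (q x).toReal) k fun N' =>
        corrExp (fun x => (p x).toReal) (fun x => (q x).toReal) m (flatWeight N N')
          ((Set.Iio t).indicator 1) := by
  simp only [acceptProb, flatTest, toReal_run_drawCounts_drawP, toReal_run_drawCounts_drawQ,
    toReal_run_drawDiff, corrExp, run, PMF.pure_apply, eq_comm (a := true), decide_eq_true_iff,
    apply_ite ENNReal.toReal, ENNReal.toReal_one, ENNReal.toReal_zero, Set.indicator_apply,
    Set.mem_Iio, Pi.one_apply]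

theorem rejectProb_flatTest (k m : ℕ) (t : ℝ) (p q : PMF X) :
    (flatTest X k m t).rejectProb p q =
      countExp (fun x => (p x).toReal) k fun N => countExp (fun x => (q x).toReal) k fun N' =>
        corrExp (fun x => (p x).toReal) (fun x => (q x).toReal) m (flatWeight N N')
          ((Set.Ici t).indicator 1) := by
  simp only [rejectProb, flatTest, toReal_run_drawCounts_drawP, toReal_run_drawCounts_drawQ,
    toReal_run_drawDiff, corrExp, run, PMF.pure_apply, eq_comm (a := false),
    decide_eq_false_iff_not, not_lt, apply_ite ENNReal.toReal, ENNReal.toReal_one,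
    ENNReal.toReal_zero, Set.indicator_apply, Set.mem_Ici, Pi.one_apply]

theorem rejectProb_flatTest_self_le (k m : ℕ) {t : ℝ} (ht : 0 < t) (p : PMF X) :
    (flatTest X k m t).rejectProb p p ≤ m ^ 2 / t ^ 2 * (4 / (k + 1)) := by
  have hp := toReal_pmf_mem_stdSimplex p
  rw [rejectProb_flatTest]
  refine (countExp_mono hp.1 k fun N _ => countExp_mono hp.1 k fun N' _ =>
    corrExp_Ici_le hp m (flatWeight N N') ht).trans ?_
  simp only [countExp_const_mul]
  exact mul_le_mul_of_nonneg_left (countExp_sum_flatWeight_sq_le hp hp k) (by positivity)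

theorem acceptProb_flatTest_le (k : ℕ) {m : ℕ} (hm : 0 < m) {ε δ : ℝ} (hε : 0 < ε) (hδ : 0 < δ)
    (hδ1 : δ ≤ 1) {p q : PMF X} (hpq : ε ≤ l1Dist p q) :
    (flatTest X k m (m ^ 2 * flatSep (Fintype.card X) k ε / 2)).acceptProb p q ≤
      δ / 2 + 36 / (δ * m ^ 2 * flatSep (Fintype.card X) k ε ^ 2) * (4 / (k + 1)) := by
  have hp := toReal_pmf_mem_stdSimplex p
  have hq := toReal_pmf_mem_stdSimplex q
  have hsep := flatSep_pos (Fintype.card_pos_iff.2 ⟨p.support_nonempty.some⟩) k hε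
  rw [acceptProb_flatTest]
  refine (countExp_mono hp.1 k fun N hN => countExp_mono hq.1 k fun N' hN' =>
    corrExp_Iio_le hp hq hm (flatWeight_nonneg N N') hsep hδ hδ1
      (flatSep_le_sum_flatWeight_mul_sq hN hN' hε.le hpq)).trans ?_
  simp only [countExp_add, countExp_const_mul, countExp_const hp.2, countExp_const hq.2]
  gcongr
  exact countExp_sum_flatWeight_sq_le hp hq k

section Correctness

variable {k m : ℕ} {ε δ : ℝ} (hε : 0 < ε) (hδ : 0 < δ) (hδ1 : δ ≤ 1)
  (hm : 288 ≤ m ^ 2 * flatSep (Fintype.card X) k ε ^ 2 * (k + 1) * δ ^ 2)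
include hε hδ hδ1 hm

theorem one_sub_le_acceptProb_flatTest_self (p : PMF X) :
    1 - δ ≤ (flatTest X k m (m ^ 2 * flatSep (Fintype.card X) k ε / 2)).acceptProb p p := by
  have hsep := flatSep_pos (Fintype.card_pos_iff.2 ⟨p.support_nonempty.some⟩) k hε
  set s := flatSep (Fintype.card X) k ε
  have hm0 : 0 < m := Nat.pos_of_ne_zero fun h => by norm_num [h] at hm
  suffices h : (flatTest X k m (m ^ 2 * s / 2)).rejectProb p p ≤ δ by
    linarith [(flatTest X k m (m ^ 2 * s / 2)).acceptProb_add_rejectProb p p]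
  calc _ ≤ m ^ 2 / (m ^ 2 * s / 2) ^ 2 * (4 / (k + 1)) :=
        rejectProb_flatTest_self_le k m (by positivity) p
    _ = 16 / (m ^ 2 * s ^ 2 * (k + 1)) := by
        field_simp
        norm_num
    _ ≤ δ := by
        rw [div_le_iff₀ (by positivity)]
        have hδ2 : m ^ 2 * s ^ 2 * (k + 1) * δ ^ 2 ≤ m ^ 2 * s ^ 2 * (k + 1) * δ := by
          gcongr
          exact pow_le_of_le_one hδ.le hδ1 two_ne_zero
        linarith

theorem one_sub_le_rejectProb_flatTest {p q : PMF X} (hpq : ε ≤ l1Dist p q) :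
    1 - δ ≤ (flatTest X k m (m ^ 2 * flatSep (Fintype.card X) k ε / 2)).rejectProb p q := by
  have hsep := flatSep_pos (Fintype.card_pos_iff.2 ⟨p.support_nonempty.some⟩) k hε
  have hm0 : 0 < m := Nat.pos_of_ne_zero fun h => by norm_num [h] at hm
  have haccept := acceptProb_flatTest_le k hm0 hε hδ hδ1 hpq
  set s := flatSep (Fintype.card X) k ε
  suffices h : (flatTest X k m (m ^ 2 * s / 2)).acceptProb p q ≤ δ by
    linarith [(flatTest X k m (m ^ 2 * s / 2)).acceptProb_add_rejectProb p q]
  calc _ ≤ δ / 2 + 36 / (δ * m ^ 2 * s ^ 2) * (4 / (k + 1)) := haccept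
    _ = δ / 2 + 144 / (δ * (m ^ 2 * s ^ 2 * (k + 1))) := by
        field_simp
        norm_num
    _ ≤ δ / 2 + δ / 2 := by
        gcongr δ / 2 + ?_
        rw [div_le_iff₀ (by positivity)]
        linarith
    _ = δ := add_halves δ

end Correctness

end FlatTest

end SampleAlg

/-- The number of samples of each distribution that determine the weights, on a domain of size
`n`. -/
noncomputable def flatSize (n : ℕ) : ℕ := ⌈(n : ℝ) ^ (2 / 3 : ℝ)⌉₊

/-- The number of samples of each distribution for each difference of counts, on a domain of size
`n`. -/
noncomputable def diffSize (n : ℕ) (ε δ : ℝ) : ℕ :=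
  ⌈17 / (flatSep n (flatSize n) ε * δ * √(flatSize n + 1))⌉₊

open Classical in
/-- The flattening test with parameters that make it an `ℓ₁`-closeness tester. -/
noncomputable def flatTester : L1Subroutine := fun X _ ε δ =>
  SampleAlg.flatTest X (flatSize (Fintype.card X)) (diffSize (Fintype.card X) ε δ)
    (diffSize (Fintype.card X) ε δ ^ 2 * flatSep (Fintype.card X) (flatSize (Fintype.card X)) ε / 2)

theorem le_diffSize_sq_mul {n : ℕ} (hn : 0 < n) {ε δ : ℝ} (hε : 0 < ε) (hδ : 0 < δ) :
    288 ≤ diffSize n ε δ ^ 2 * flatSep n (flatSize n) ε ^ 2 * (flatSize n + 1) * δ ^ 2 := by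
  have hsep := flatSep_pos hn (flatSize n) hε
  have hceil := Nat.le_ceil (17 / (flatSep n (flatSize n) ε * δ * √(flatSize n + 1)))
  rw [← diffSize, div_le_iff₀ (by positivity)] at hceil
  calc (288 : ℝ) ≤ 17 ^ 2 := by norm_num
    _ ≤ (diffSize n ε δ * (flatSep n (flatSize n) ε * δ * √(flatSize n + 1))) ^ 2 := by gcongr
    _ = diffSize n ε δ ^ 2 * flatSep n (flatSize n) ε ^ 2 * √(flatSize n + 1) ^ 2 * δ ^ 2 := by
        ring
    _ = _ := by rw [Real.sq_sqrt (by positivity)]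

theorem isL1ClosenessTester_flatTester : IsL1ClosenessTester flatTester := by
  classical
  intro X _ ε δ hε hδ hδ1 p q
  have hm := le_diffSize_sq_mul (Fintype.card_pos_iff.2 ⟨p.support_nonempty.some⟩) hε hδ
  constructor
  · rintro rfl
    exact SampleAlg.one_sub_le_acceptProb_flatTest_self hε hδ hδ1.le hm p
  · exact fun hpq => SampleAlg.one_sub_le_rejectProb_flatTest hε hδ hδ1.le hm hpq.le

theorem flatSize_le (n : ℕ) : (flatSize n : ℝ) ≤ n ^ (2 / 3 : ℝ) + 1 :=
  (Nat.ceil_lt_add_one (by positivity)).le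

theorem flatSize_le_self {n : ℕ} (hn : 0 < n) : flatSize n ≤ n := by
  refine Nat.ceil_le.2 ?_
  calc (n : ℝ) ^ (2 / 3 : ℝ) ≤ (n : ℝ) ^ (1 : ℝ) :=
        Real.rpow_le_rpow_of_exponent_le (Nat.one_le_cast.2 hn) (by norm_num)
    _ = n := Real.rpow_one _

theorem rpow_le_sqrt_flatSize_add_one (n : ℕ) :
    (n : ℝ) ^ (1 / 3 : ℝ) ≤ √(flatSize n + 1) := by
  refine Real.le_sqrt_of_sq_le ?_
  calc ((n : ℝ) ^ (1 / 3 : ℝ)) ^ 2 = (n : ℝ) ^ (2 / 3 : ℝ) := by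
        rw [← Real.rpow_mul_natCast n.cast_nonneg]
        norm_num
    _ ≤ flatSize n := Nat.le_ceil _
    _ ≤ flatSize n + 1 := le_add_of_nonneg_right zero_le_one

theorem diffSize_le {n : ℕ} (hn : 0 < n) {ε δ : ℝ} (hε : 0 < ε) (hδ : 0 < δ) :
    (diffSize n ε δ : ℝ) ≤ 51 * n ^ (2 / 3 : ℝ) / (ε ^ 2 * δ) + 1 := by
  have hn' : (0 : ℝ) < n := Nat.cast_pos.2 hn
  have hsep := flatSep_pos hn (flatSize n) hε
  have hsplit : (n : ℝ) = n ^ (2 / 3 : ℝ) * n ^ (1 / 3 : ℝ) := by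
    rw [← Real.rpow_add hn']
    norm_num
  refine (Nat.ceil_lt_add_one (by positivity)).le.trans (add_le_add_left ?_ 1)
  calc 17 / (flatSep n (flatSize n) ε * δ * √(flatSize n + 1))
      = 17 * (n + 2 * flatSize n) / (ε ^ 2 * δ * √(flatSize n + 1)) := by
        unfold flatSep
        field_simp
    _ ≤ 17 * (n + 2 * n) / (ε ^ 2 * δ * n ^ (1 / 3 : ℝ)) := by
        gcongr
        · exact flatSize_le_self hn
        · exact rpow_le_sqrt_flatSize_add_one n
    _ = 51 * (n ^ (2 / 3 : ℝ) * n ^ (1 / 3 : ℝ)) / (ε ^ 2 * δ * n ^ (1 / 3 : ℝ)) := by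
        rw [← hsplit]
        ring
    _ = 51 * n ^ (2 / 3 : ℝ) / (ε ^ 2 * δ) := by
        rw [← mul_assoc, mul_div_mul_right _ _ (by positivity)]

theorem samples_flatTester_le {X : Type} [Fintype X] [Nonempty X] {ε δ : ℝ} (hε : 0 < ε)
    (hδ : 0 < δ) :
    (flatTester X ε δ).samples ≤
      (⌊8 * (Fintype.card X : ℝ) ^ (2 / 3 : ℝ) * (1 + 26 / (ε ^ 2 * δ))⌋₊ : ℕ∞) := by
  classical
  set n := Fintype.card X with hn_def
  have hn : 0 < n := Fintype.card_pos
  have hr : 1 ≤ (n : ℝ) ^ (2 / 3 : ℝ) := Real.one_le_rpow (Nat.one_le_cast.2 hn) (by norm_num)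
  refine (SampleAlg.samples_flatTest_le _ _ _).trans (Nat.cast_le.2 (Nat.le_floor ?_))
  rw [← hn_def]
  push_cast
  calc 2 * (flatSize n : ℝ) + 4 * diffSize n ε δ
      ≤ 2 * (n ^ (2 / 3 : ℝ) + 1) + 4 * (51 * n ^ (2 / 3 : ℝ) / (ε ^ 2 * δ) + 1) := by
        gcongr
        · exact flatSize_le n
        · exact diffSize_le hn hε hδ
    _ = 2 * (n : ℝ) ^ (2 / 3 : ℝ) + 6 * 1 + 204 * (n ^ (2 / 3 : ℝ) / (ε ^ 2 * δ)) := by ring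
    _ ≤ 2 * (n : ℝ) ^ (2 / 3 : ℝ) + 6 * n ^ (2 / 3 : ℝ) +
          208 * (n ^ (2 / 3 : ℝ) / (ε ^ 2 * δ)) := by
        gcongr
        norm_num
    _ = 8 * (n : ℝ) ^ (2 / 3 : ℝ) * (1 + 26 / (ε ^ 2 * δ)) := by ring

/-! ### Bounding the Earth Mover's Distance by the coarsenings -/

theorem emd_le_of_isSatisfyingFlow {M : Type} [Fintype M] [MetricSpace M] {p q : PMF M}
    {f : M → M → ℝ} (hf : IsSatisfyingFlow p q f) : EMD p q ≤ ∑ x, ∑ y, f x y * dist x y := by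
  refine csInf_le ⟨0, ?_⟩ ⟨f, hf, rfl⟩
  rintro _ ⟨g, hg, rfl⟩
  exact Finset.sum_nonneg fun x _ => Finset.sum_nonneg fun y _ =>
    mul_nonneg (hg.nonneg x y) dist_nonneg

section Coarsening

variable {M Y : Type*} [Fintype M] [DecidableEq Y]

/-- The weights that `P` induces on the cells (the fibers of `π`) of a partition of `M`; this is
the analogue for real weights of `PMF.map`. -/
noncomputable def coarsening (π : M → Y) (P : M → ℝ) (c : Y) : ℝ := ∑ x with π x = c, P x

theorem toReal_pmf_map_apply (p : PMF M) (π : M → Y) (c : Y) :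
    (p.map π c).toReal = coarsening π (fun x => (p x).toReal) c := by
  rw [PMF.map, toReal_pmf_bind_apply, coarsening, Finset.sum_filter]
  refine Finset.sum_congr rfl fun x _ => ?_
  by_cases hx : π x = c <;> simp [hx, eq_comm (a := c)]

theorem coarsening_nonneg (π : M → Y) {P : M → ℝ} (hP : ∀ x, 0 ≤ P x) (c : Y) :
    0 ≤ coarsening π P c :=
  Finset.sum_nonneg fun x _ => hP x

theorem coarsening_sub (π : M → Y) (P Q : M → ℝ) (c : Y) :
    coarsening π (fun x => P x - Q x) c = coarsening π P c - coarsening π Q c :=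
  Finset.sum_sub_distrib ..

variable [Fintype Y]

theorem sum_coarsening_mul (π : M → Y) (P : M → ℝ) (h : Y → ℝ) :
    ∑ c, coarsening π P c * h c = ∑ x, P x * h (π x) := by
  rw [← Finset.sum_fiberwise _ π]
  refine Finset.sum_congr rfl fun c _ => ?_
  rw [coarsening, Finset.sum_mul]
  exact Finset.sum_congr rfl fun x hx => by rw [(Finset.mem_filter.1 hx).2]

theorem sum_coarsening (π : M → Y) (P : M → ℝ) : ∑ c, coarsening π P c = ∑ x, P x := by
  simpa only [mul_one] using sum_coarsening_mul π P fun _ => 1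

/-- The largest mass that can be moved from the supply `P` to the demand `Q` inside the cells of
the partition `π`. -/
noncomputable def commonMass (π : M → Y) (P Q : M → ℝ) : ℝ :=
  ∑ c, min (coarsening π P c) (coarsening π Q c)

end Coarsening

theorem sum_min_toReal {X : Type} [Fintype X] (p q : PMF X) :
    ∑ x, min (p x).toReal (q x).toReal = 1 - l1Dist p q / 2 := by
  have hmin (a b : ℝ) : min a b = (a + b - |a - b|) / 2 := by
    rw [inf_eq_half_smul_add_sub_abs_sub ℝ, abs_sub_comm, smul_eq_mul, invOf_eq_inv]
    ring
  simp only [hmin, ← Finset.sum_div, Finset.sum_sub_distrib, Finset.sum_add_distrib,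
    (toReal_pmf_mem_stdSimplex _).2, l1Dist]
  ring

theorem commonMass_toReal {M Y : Type} [Fintype M] [Fintype Y] [DecidableEq Y] (π : M → Y)
    (p q : PMF M) :
    commonMass π (fun x => (p x).toReal) (fun x => (q x).toReal) =
      1 - l1Dist (p.map π) (q.map π) / 2 := by
  simp only [commonMass, ← toReal_pmf_map_apply, sum_min_toReal]

theorem l1Dist_eq_zero_of_subsingleton {X : Type} [Fintype X] [Subsingleton X] (p q : PMF X) :
    l1Dist p q = 0 := by
  refine Finset.sum_eq_zero fun x _ => ?_
  have h_one (r : PMF X) : (r x).toReal = 1 := by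
    rw [← (toReal_pmf_mem_stdSimplex r).2, Fintype.sum_subsingleton _ x]
  rw [h_one, h_one, sub_self, abs_zero]

section PartialFlow

variable {M Y : Type*} [Fintype M]

/-- `f` is a flow with supply at most `P` and demand at most `Q` that only moves mass inside the
cells of the partition `π`. -/
structure IsPartialFlow (P Q : M → ℝ) (π : M → Y) (f : M → M → ℝ) : Prop where
  nonneg : ∀ x y, 0 ≤ f x y
  supply_le : ∀ x, ∑ y, f x y ≤ P x
  demand_le : ∀ y, ∑ x, f x y ≤ Q y
  eq_zero : ∀ x y, π x ≠ π y → f x y = 0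

namespace IsPartialFlow

variable {P Q : M → ℝ} {π : M → Y} {f g : M → M → ℝ}

theorem zero (hP : ∀ x, 0 ≤ P x) (hQ : ∀ x, 0 ≤ Q x) (π : M → Y) :
    IsPartialFlow P Q π fun _ _ => 0 :=
  ⟨by simp, by simpa using hP, by simpa using hQ, by simp⟩

theorem coarsen {Z : Type*} (hf : IsPartialFlow P Q π f) {ρ : M → Z}
    (h : ∀ x y, π x = π y → ρ x = ρ y) : IsPartialFlow P Q ρ f :=
  ⟨hf.nonneg, hf.supply_le, hf.demand_le, fun x y hxy => hf.eq_zero x y fun e => hxy (h x y e)⟩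

theorem add (hf : IsPartialFlow P Q π f)
    (hg : IsPartialFlow (fun x => P x - ∑ y, f x y) (fun y => Q y - ∑ x, f x y) π g) :
    IsPartialFlow P Q π fun x y => f x y + g x y where
  nonneg x y := add_nonneg (hf.nonneg x y) (hg.nonneg x y)
  supply_le x := by
    rw [Finset.sum_add_distrib]
    linarith [hg.supply_le x]
  demand_le y := by
    rw [Finset.sum_add_distrib]
    linarith [hg.demand_le y]
  eq_zero x y hxy := by rw [hf.eq_zero x y hxy, hg.eq_zero x y hxy, add_zero]

theorem sum_mul_le (hf : IsPartialFlow P Q π f) {D : M → M → ℝ} {r : ℝ}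
    (hr : ∀ x y, π x = π y → D x y ≤ r) :
    ∑ x, ∑ y, f x y * D x y ≤ r * ∑ x, ∑ y, f x y := by
  simp only [Finset.mul_sum]
  refine Finset.sum_le_sum fun x _ => Finset.sum_le_sum fun y _ => ?_
  by_cases hxy : π x = π y
  · rw [mul_comm]
    exact mul_le_mul_of_nonneg_right (hr x y hxy) (hf.nonneg x y)
  · simp [hf.eq_zero x y hxy]

theorem coarsening_supply_eq_coarsening_demand [DecidableEq Y] (hf : IsPartialFlow P Q π f)
    (c : Y) : coarsening π (fun x => ∑ y, f x y) c = coarsening π (fun y => ∑ x, f x y) c := by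
  have h_row (x : M) (hx : x ∈ Finset.univ.filter fun x => π x = c) :
      ∑ y with π y = c, f x y = ∑ y, f x y :=
    Finset.sum_filter_of_ne fun y _ hy =>
      (not_imp_comm.1 (hf.eq_zero x y) hy).symm.trans (Finset.mem_filter.1 hx).2
  have h_col (y : M) (hy : y ∈ Finset.univ.filter fun y => π y = c) :
      ∑ x with π x = c, f x y = ∑ x, f x y :=
    Finset.sum_filter_of_ne fun x _ hx =>
      (not_imp_comm.1 (hf.eq_zero x y) hx).trans (Finset.mem_filter.1 hy).2
  rw [coarsening, coarsening, ← Finset.sum_congr rfl h_row, ← Finset.sum_congr rfl h_col,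
    Finset.sum_comm]

theorem isSatisfyingFlow {M : Type} [Fintype M] {p q : PMF M} {π : M → Y} {f : M → M → ℝ}
    (hf : IsPartialFlow (fun x => (p x).toReal) (fun x => (q x).toReal) π f)
    (h_mass : ∑ x, ∑ y, f x y = 1) : IsSatisfyingFlow p q f where
  nonneg := hf.nonneg
  supply x := (Finset.sum_eq_sum_iff_of_le fun x _ => hf.supply_le x).1
    (h_mass.trans (toReal_pmf_mem_stdSimplex p).2.symm) x (Finset.mem_univ x)
  demand y := (Finset.sum_eq_sum_iff_of_le fun y _ => hf.demand_le y).1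
    ((Finset.sum_comm.trans h_mass).trans (toReal_pmf_mem_stdSimplex q).2.symm) y
    (Finset.mem_univ y)

end IsPartialFlow

section CellFlow

variable [DecidableEq Y]

/-- The flow that moves as much of the supply `P` to the demand `Q` as possible inside each cell
of the partition `π`, proportionally to supply and demand. In a cell without supply and demand the
denominator vanishes, and so does the flow. -/
noncomputable def cellFlow (P Q : M → ℝ) (π : M → Y) (x y : M) : ℝ :=
  if π x = π y then P x * Q y / max (coarsening π P (π x)) (coarsening π Q (π x)) else 0

theorem cellFlow_swap (P Q : M → ℝ) (π : M → Y) (x y : M) :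
    cellFlow P Q π x y = cellFlow Q P π y x := by
  by_cases hxy : π x = π y
  · simp [cellFlow, hxy, mul_comm, max_comm]
  · simp [cellFlow, hxy, Ne.symm hxy]

theorem sum_cellFlow (P Q : M → ℝ) (π : M → Y) (x : M) :
    ∑ y, cellFlow P Q π x y = P x *
      (coarsening π Q (π x) / max (coarsening π P (π x)) (coarsening π Q (π x))) := by
  simp only [cellFlow, eq_comm (a := π x), ← Finset.sum_filter, ← Finset.sum_div,
    ← Finset.mul_sum, mul_div_assoc]
  rfl

variable {P Q : M → ℝ} (hP : ∀ x, 0 ≤ P x) (hQ : ∀ x, 0 ≤ Q x)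
include hP hQ

theorem isPartialFlow_cellFlow (π : M → Y) : IsPartialFlow P Q π (cellFlow P Q π) where
  nonneg x y := by
    have h_coarse := coarsening_nonneg π hP (π x)
    have hPx := hP x
    have hQy := hQ y
    unfold cellFlow
    positivity
  supply_le x := by
    rw [sum_cellFlow]
    exact mul_le_of_le_one_right (hP x) (div_le_one_of_le₀ (le_max_right _ _)
      (le_max_of_le_left (coarsening_nonneg π hP _)))
  demand_le y := by
    simp only [cellFlow_swap P Q]
    rw [sum_cellFlow]
    exact mul_le_of_le_one_right (hQ y) (div_le_one_of_le₀ (le_max_right _ _)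
      (le_max_of_le_left (coarsening_nonneg π hQ _)))
  eq_zero x y hxy := if_neg hxy

theorem sum_sum_cellFlow [Fintype Y] (π : M → Y) :
    ∑ x, ∑ y, cellFlow P Q π x y = commonMass π P Q := by
  simp only [sum_cellFlow]
  rw [← sum_coarsening_mul π P fun c =>
    coarsening π Q c / max (coarsening π P c) (coarsening π Q c), commonMass]
  refine Finset.sum_congr rfl fun c _ => ?_
  have ha := coarsening_nonneg π hP c
  have hb := coarsening_nonneg π hQ c
  rcases (le_max_of_le_left ha :
    0 ≤ max (coarsening π P c) (coarsening π Q c)).eq_or_lt with h_zero | h_pos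
  · rw [le_antisymm ((le_max_left _ _).trans h_zero.ge) ha,
      le_antisymm ((le_max_right _ _).trans h_zero.ge) hb]
    simp
  · rw [← mul_div_assoc, div_eq_iff h_pos.ne', min_mul_max]

end CellFlow

variable [DecidableEq Y] [Fintype Y] {P Q : M → ℝ} {π : M → Y} {f : M → M → ℝ}

theorem IsPartialFlow.commonMass_residual (hf : IsPartialFlow P Q π f) :
    commonMass π (fun x => P x - ∑ y, f x y) (fun y => Q y - ∑ x, f x y) =
      commonMass π P Q - ∑ x, ∑ y, f x y := by
  simp only [commonMass, coarsening_sub, ← hf.coarsening_supply_eq_coarsening_demand,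
    min_sub_sub_right, Finset.sum_sub_distrib, sum_coarsening]

theorem IsPartialFlow.exists_extension (hf : IsPartialFlow P Q π f) {D : M → M → ℝ} {r : ℝ}
    (hr : ∀ x y, π x = π y → D x y ≤ r) :
    ∃ g : M → M → ℝ, IsPartialFlow P Q π g ∧ ∑ x, ∑ y, g x y = commonMass π P Q ∧
      ∑ x, ∑ y, g x y * D x y ≤
        ∑ x, ∑ y, f x y * D x y + r * (commonMass π P Q - ∑ x, ∑ y, f x y) := by
  have hP (x : M) : 0 ≤ P x - ∑ y, f x y := sub_nonneg.2 (hf.supply_le x)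
  have hQ (y : M) : 0 ≤ Q y - ∑ x, f x y := sub_nonneg.2 (hf.demand_le y)
  have h_cell := isPartialFlow_cellFlow hP hQ π
  have h_mass := (sum_sum_cellFlow hP hQ π).trans hf.commonMass_residual
  refine ⟨_, hf.add h_cell, ?_, ?_⟩
  · simp only [Finset.sum_add_distrib, h_mass, add_sub_cancel]
  · simp only [add_mul, Finset.sum_add_distrib, ← h_mass]
    gcongr
    exact h_cell.sum_mul_le hr

end PartialFlow

theorem exists_isPartialFlow_of_nested {M : Type*} [Fintype M] {P Q : M → ℝ}
    (hP : ∀ x, 0 ≤ P x) (hQ : ∀ x, 0 ≤ Q x) {D : M → M → ℝ} (L : ℕ) {Y : ℕ → Type*}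
    [∀ i, Fintype (Y i)] [∀ i, DecidableEq (Y i)] (π : ∀ i, M → Y i) {r : ℕ → ℝ}
    (hπ : ∀ i x y, π (i + 1) x = π (i + 1) y → π i x = π i y)
    (hr : ∀ i x y, π i x = π i y → D x y ≤ r i) :
    ∃ f : M → M → ℝ, IsPartialFlow P Q (π 0) f ∧ ∑ x, ∑ y, f x y = commonMass (π 0) P Q ∧
      ∑ x, ∑ y, f x y * D x y ≤ r L * commonMass (π L) P Q +
        ∑ i ∈ Finset.range L, r i * (commonMass (π i) P Q - commonMass (π (i + 1)) P Q) := by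
  induction L generalizing Y r with
  | zero => simpa using (IsPartialFlow.zero hP hQ (π 0)).exists_extension (hr 0)
  | succ L ih =>
    obtain ⟨f, hf, hf_mass, hf_cost⟩ :=
      ih (fun i => π (i + 1)) (fun i => hπ (i + 1)) (fun i => hr (i + 1))
    obtain ⟨g, hg, hg_mass, hg_cost⟩ := (hf.coarsen (hπ 0)).exists_extension (hr 0)
    refine ⟨g, hg, hg_mass, ?_⟩
    rw [hf_mass] at hg_cost
    rw [Finset.sum_range_succ']
    linarith [hf_cost, hg_cost]

theorem emd_le_add_sum_l1Dist {M : Type} [Fintype M] [MetricSpace M] {Y : ℕ → Type}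
    [∀ i, Fintype (Y i)] [Subsingleton (Y 0)] (π : ∀ i, M → Y i) {r : ℕ → ℝ}
    (hπ : ∀ i x y, π (i + 1) x = π (i + 1) y → π i x = π i y)
    (hr : ∀ i x y, π i x = π i y → dist x y ≤ r i) (p q : PMF M) (L : ℕ) :
    EMD p q ≤ r L + ∑ i ∈ Finset.range L,
      (r i - r (i + 1)) * (l1Dist (p.map (π (i + 1))) (q.map (π (i + 1))) / 2) := by
  classical
  obtain ⟨f, hf, h_mass, h_cost⟩ := exists_isPartialFlow_of_nested
    (toReal_pmf_mem_stdSimplex p).1 (toReal_pmf_mem_stdSimplex q).1 L π hπ hr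
  simp only [commonMass_toReal] at h_mass h_cost
  have h_zero : l1Dist (p.map (π 0)) (q.map (π 0)) = 0 := l1Dist_eq_zero_of_subsingleton _ _
  refine (emd_le_of_isSatisfyingFlow (hf.isSatisfyingFlow (by simpa [h_zero] using h_mass))).trans
    (h_cost.trans_eq ?_)
  clear h_cost
  induction L with
  | zero => simp [h_zero]
  | succ L ih =>
    rw [Finset.sum_range_succ, Finset.sum_range_succ]
    linarith

/-! ### Dyadic grids -/

section Grid

variable {d : ℕ} {Δ : ℝ} {i : ℕ} {x y : L1Space d}

theorem gridCell_eq_of_succ (h : gridCell Δ (i + 1) x = gridCell Δ (i + 1) y) :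
    gridCell Δ i x = gridCell Δ i y := by
  have h_floor (u : ℝ) : ⌊u / (Δ / 2 ^ i)⌋₊ = ⌊u / (Δ / 2 ^ (i + 1))⌋₊ / 2 := by
    rw [← Nat.floor_div_ofNat]
    congr 1
    rw [pow_succ]
    field_simp
  ext j
  have hj := congrArg Fin.val (congrFun h j)
  simp only [gridCell, h_floor, pow_succ] at hj ⊢
  have := Nat.two_pow_pos i
  omega

theorem mem_Icc_gridCell (hΔ : 0 < Δ) (i : ℕ) {j : Fin d} (hx : x j ∈ Set.Icc 0 Δ) :
    x j ∈ Set.Icc ((gridCell Δ i x j : ℝ) * (Δ / 2 ^ i))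
      ((gridCell Δ i x j : ℝ) * (Δ / 2 ^ i) + Δ / 2 ^ i) := by
  have h_side : 0 < Δ / 2 ^ i := by positivity
  constructor
  · rw [← le_div_iff₀ h_side]
    exact (Nat.cast_le.2 (min_le_left _ _)).trans (Nat.floor_le (div_nonneg hx.1 h_side.le))
  · rw [← add_one_mul, ← div_le_iff₀ h_side]
    rcases min_cases ⌊x j / (Δ / 2 ^ i)⌋₊ (2 ^ i - 1) with ⟨h_cell, -⟩ | ⟨h_cell, -⟩ <;>
      simp only [gridCell, h_cell]
    · exact (Nat.lt_floor_add_one _).le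
    · rw [div_le_iff₀ h_side, Nat.cast_sub Nat.one_le_two_pow]
      push_cast
      rw [sub_add_cancel, mul_div_cancel₀ _ (by positivity)]
      exact hx.2

theorem dist_le_of_gridCell_eq (hΔ : 0 < Δ) (hx : ∀ j, x j ∈ Set.Icc 0 Δ)
    (hy : ∀ j, y j ∈ Set.Icc 0 Δ) (h : gridCell Δ i x = gridCell Δ i y) :
    dist x y ≤ Δ * d / 2 ^ i := by
  have h_coord (j : Fin d) : dist (x j) (y j) ≤ Δ / 2 ^ i := by
    have hyj := mem_Icc_gridCell hΔ i (hy j)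
    rw [← h] at hyj
    simpa using Real.dist_le_of_mem_Icc (mem_Icc_gridCell hΔ i (hx j)) hyj
  calc dist x y = ∑ j, dist (x j) (y j) := PiLp.dist_eq_of_L1 _ _
    _ ≤ ∑ _j : Fin d, Δ / 2 ^ i := Finset.sum_le_sum fun j _ => h_coord j
    _ = Δ * d / 2 ^ i := by simp; ring

end Grid

theorem emd_le_add_sum_l1Dist_gridCell {d : ℕ} {Δ : ℝ} (hΔ : 0 < Δ) {M : Finset (L1Space d)}
    (hM : ∀ x ∈ M, ∀ j, x j ∈ Set.Icc 0 Δ) (p q : PMF M) (L : ℕ) :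
    EMD p q ≤ Δ * d / 2 ^ L + ∑ i ∈ Finset.range L, Δ * d / 2 ^ (i + 1) *
      (l1Dist ((p.map Subtype.val).map (gridCell Δ (i + 1)))
        ((q.map Subtype.val).map (gridCell Δ (i + 1))) / 2) := by
  have : Subsingleton (GridCell d 0) := inferInstanceAs (Subsingleton (Fin d → Fin 1))
  have h_halve (i : ℕ) : Δ * d / 2 ^ i - Δ * d / 2 ^ (i + 1) = Δ * d / 2 ^ (i + 1) := by
    rw [pow_succ]
    field_simp
    norm_num
  simpa only [PMF.map_comp, h_halve] using
    emd_le_add_sum_l1Dist (Y := GridCell d) (fun i => gridCell Δ i ∘ Subtype.val)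
      (fun _ _ _ => gridCell_eq_of_succ)
      (fun _ x y => dist_le_of_gridCell_eq hΔ (hM x x.2) (hM y y.2)) p q L

theorem le_two_pow_ceil_logb (x : ℝ) : x ≤ 2 ^ ⌈Real.logb 2 x⌉₊ := by
  rcases le_or_gt x 0 with hx | hx
  · exact hx.trans (by positivity)
  · rw [← Real.rpow_natCast, ← Real.logb_le_iff_le_rpow one_lt_two hx]
    exact Nat.le_ceil _

/-! ### Correctness -/

/-- The distance parameter of the `ℓ₁` tester in the run of EMD-Closeness-Tester on the
`i`-coarsenings. -/
noncomputable def scaleDist (d : ℕ) (Δ ε : ℝ) (i : ℕ) : ℝ :=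
  ε * (2 : ℝ) ^ ((i : ℤ) - 2) / (Δ * d * numScales d Δ ε)

/-- The run of EMD-Closeness-Tester on the `i`-coarsenings. -/
noncomputable def scaleTest (T : L1Subroutine) (d : ℕ) (Δ ε : ℝ) (i : ℕ) :
    SampleAlg (L1Space d) Bool :=
  (T (GridCell d i) (scaleDist d Δ ε i) (1 / (3 * numScales d Δ ε))).comap (gridCell Δ i)

theorem emdClosenessTester_eq_allAccept (T : L1Subroutine) (d : ℕ) (Δ ε : ℝ) :
    emdClosenessTester T d Δ ε =
      SampleAlg.allAccept ((List.range' 1 (numScales d Δ ε)).map (scaleTest T d Δ ε)) := rfl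

theorem dim_pos_of_numScales_pos {d : ℕ} {Δ ε : ℝ} (hL : 0 < numScales d Δ ε) : 0 < d := by
  rw [Nat.pos_iff_ne_zero]
  rintro rfl
  simp [numScales] at hL

section Correctness

variable {d : ℕ} {Δ ε : ℝ}

theorem numScales_pos_of_mem_range' {i : ℕ} (hi : i ∈ List.range' 1 (numScales d Δ ε)) :
    0 < numScales d Δ ε := by
  rw [List.mem_range'_1] at hi
  omega

variable (hΔ : 0 < Δ) (hε : 0 < ε)
include hΔ hε

theorem scaleDist_pos (hL : 0 < numScales d Δ ε) (i : ℕ) : 0 < scaleDist d Δ ε i := by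
  have := dim_pos_of_numScales_pos hL
  unfold scaleDist
  positivity

theorem exists_lt_l1Dist_of_lt_emd {M : Finset (L1Space d)}
    (hM : ∀ x ∈ M, ∀ j, x j ∈ Set.Icc 0 Δ) {p q : PMF M} (h : ε < EMD p q) :
    ∃ i ∈ List.range' 1 (numScales d Δ ε), scaleDist d Δ ε i <
      l1Dist ((p.map Subtype.val).map (gridCell Δ i))
        ((q.map Subtype.val).map (gridCell Δ i)) := by
  by_contra! h_close
  set L := numScales d Δ ε with hL_def
  have h_coarsest : Δ * d / 2 ^ L ≤ ε / 2 := by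
    have h2L := le_two_pow_ceil_logb (2 * Δ * d / ε)
    rw [← numScales, ← hL_def, div_le_iff₀ hε] at h2L
    rw [div_le_iff₀ (by positivity)]
    linarith
  have h_scale (i : ℕ) (hi : i ∈ Finset.range L) : Δ * d / 2 ^ (i + 1) *
      (l1Dist ((p.map Subtype.val).map (gridCell Δ (i + 1)))
        ((q.map Subtype.val).map (gridCell Δ (i + 1))) / 2) ≤ ε / (8 * L) := by
    rw [Finset.mem_range] at hi
    have hL : 0 < L := by omega
    have hd := dim_pos_of_numScales_pos hL
    calc _ ≤ Δ * d / 2 ^ (i + 1) * (scaleDist d Δ ε (i + 1) / 2) := by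
          gcongr
          exact h_close _ (List.mem_range'_1.2 ⟨by omega, by omega⟩)
      _ = ε / (8 * L) := by
          rw [scaleDist, zpow_sub₀ two_ne_zero, zpow_natCast, ← hL_def]
          field_simp
          norm_num
  have h_sum := Finset.sum_le_card_nsmul _ _ _ h_scale
  rw [Finset.card_range, nsmul_eq_mul] at h_sum
  have h_const : L * (ε / (8 * L)) ≤ ε / 8 := by
    rw [← div_div, mul_div_left_comm]
    exact mul_le_of_le_one_right (by positivity) (div_self_le_one _)
  linarith [emd_le_add_sum_l1Dist_gridCell hΔ hM p q L]

variable {T : L1Subroutine} (hT : IsL1ClosenessTester T)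
include hT

theorem rejectProb_scaleTest_self_le (hL : 0 < numScales d Δ ε) (i : ℕ) (p : PMF (L1Space d)) :
    (scaleTest T d Δ ε i).rejectProb p p ≤ 1 / (3 * numScales d Δ ε) := by
  have hL' : (1 : ℝ) ≤ numScales d Δ ε := mod_cast hL
  have h_accept := (hT (GridCell d i) (scaleDist d Δ ε i) (1 / (3 * numScales d Δ ε))
    (scaleDist_pos hΔ hε hL i) (by positivity)
    (by rw [div_lt_one (by positivity)]; linarith) (p.map (gridCell Δ i)) _).1 rfl
  rw [← SampleAlg.acceptProb_comap, ← scaleTest] at h_accept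
  linarith [(scaleTest T d Δ ε i).acceptProb_add_rejectProb p p]

theorem two_thirds_le_rejectProb_scaleTest (hL : 0 < numScales d Δ ε) {i : ℕ}
    {p q : PMF (L1Space d)}
    (h : scaleDist d Δ ε i < l1Dist (p.map (gridCell Δ i)) (q.map (gridCell Δ i))) :
    2 / 3 ≤ (scaleTest T d Δ ε i).rejectProb p q := by
  have hL' : (1 : ℝ) ≤ numScales d Δ ε := mod_cast hL
  have hδ : 1 / (3 * (numScales d Δ ε : ℝ)) ≤ 1 / 3 := by
    gcongr
    linarith
  have h_reject := (hT (GridCell d i) _ (1 / (3 * numScales d Δ ε))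
    (scaleDist_pos hΔ hε hL i) (by positivity) (by linarith) _ _).2 h
  rw [← SampleAlg.rejectProb_comap, ← scaleTest] at h_reject
  linarith

theorem two_thirds_le_acceptProb_emdClosenessTester_self (p : PMF (L1Space d)) :
    2 / 3 ≤ (emdClosenessTester T d Δ ε).acceptProb p p := by
  suffices h : (emdClosenessTester T d Δ ε).rejectProb p p ≤ 1 / 3 by
    linarith [(emdClosenessTester T d Δ ε).acceptProb_add_rejectProb p p]
  calc (emdClosenessTester T d Δ ε).rejectProb p p
    _ ≤ _ := SampleAlg.rejectProb_allAccept_le_sum p p _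
    _ ≤ numScales d Δ ε * (1 / (3 * numScales d Δ ε) : ℝ) := by
        refine (List.sum_le_card_nsmul _ (1 / (3 * numScales d Δ ε) : ℝ) ?_).trans_eq (by simp)
        simp only [List.forall_mem_map]
        exact fun i hi =>
          rejectProb_scaleTest_self_le hΔ hε hT (numScales_pos_of_mem_range' hi) i p
    _ ≤ 1 / 3 := by
        rw [← div_div, mul_div_left_comm]
        exact mul_le_of_le_one_right (by positivity) (div_self_le_one _)

end Correctness
theorem isEMDClosenessTester_emdClosenessTester {T : L1Subroutine} (hT : IsL1ClosenessTester T)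
    {d : ℕ} {Δ : ℝ} (hΔ : 0 < Δ) {M : Finset (L1Space d)}
    (hM : ∀ x ∈ M, ∀ j, x j ∈ Set.Icc 0 Δ) :
    IsEMDClosenessTester (M := M) fun ε => (emdClosenessTester T d Δ ε).comap Subtype.val := by
  intro ε hε p q
  rw [SampleAlg.acceptProb_comap, SampleAlg.rejectProb_comap]
  constructor
  · rintro rfl
    exact two_thirds_le_acceptProb_emdClosenessTester_self hΔ hε hT _
  · intro h_emd
    obtain ⟨i, hi, h_far⟩ := exists_lt_l1Dist_of_lt_emd hΔ hε hM h_emd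
    rw [emdClosenessTester_eq_allAccept]
    exact (two_thirds_le_rejectProb_scaleTest hΔ hε hT (numScales_pos_of_mem_range' hi) h_far).trans
      (SampleAlg.rejectProb_le_rejectProb_allAccept _ _ (List.mem_map_of_mem hi))

/-! ### Sample complexity -/

theorem ceil_logb_le_logb_add_one {x : ℝ} (hx : 1 ≤ x) :
    (⌈Real.logb 2 x⌉₊ : ℝ) ≤ Real.logb 2 x + 1 :=
  (Nat.ceil_lt_add_one (Real.logb_nonneg one_lt_two hx)).le

theorem two_pow_ceil_logb_le {x : ℝ} (hx : 1 ≤ x) : (2 : ℝ) ^ ⌈Real.logb 2 x⌉₊ ≤ 2 * x := by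
  calc (2 : ℝ) ^ ⌈Real.logb 2 x⌉₊ = (2 : ℝ) ^ (⌈Real.logb 2 x⌉₊ : ℝ) := (Real.rpow_natCast _ _).symm
    _ ≤ (2 : ℝ) ^ (Real.logb 2 x + 1) :=
        Real.rpow_le_rpow_of_exponent_le one_le_two (ceil_logb_le_logb_add_one hx)
    _ = 2 * x := by
        rw [Real.rpow_add two_pos, Real.rpow_logb two_pos (by norm_num) (by linarith),
          Real.rpow_one, mul_comm]

theorem ceil_logb_eq_zero {x : ℝ} (hx₀ : 0 ≤ x) (hx₁ : x ≤ 1) : ⌈Real.logb 2 x⌉₊ = 0 :=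
  Nat.ceil_eq_zero.2 (Real.logb_nonpos one_lt_two hx₀ hx₁)

theorem ceil_logb_le_log {x : ℝ} (hx : 0 ≤ x) :
    (⌈Real.logb 2 x⌉₊ : ℝ) ≤ 3 * Real.log (2 + x) := by
  have h_log_two := Real.log_two_gt_d9
  have h_log : Real.log 2 ≤ Real.log (2 + x) := Real.log_le_log two_pos (by linarith)
  rcases le_total x 1 with hx1 | hx1
  · rw [ceil_logb_eq_zero hx hx1, Nat.cast_zero]
    linarith
  · have h_logb : Real.logb 2 x ≤ 2 * Real.log (2 + x) - 1 + Real.log (2 + x) := by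
      rw [Real.logb, div_le_iff₀ (by linarith)]
      have h_log_le : Real.log x ≤ Real.log (2 + x) := Real.log_le_log (by linarith) (by linarith)
      nlinarith
    linarith [ceil_logb_le_logb_add_one hx1]

theorem rpow_mul_rpow_le_mul_rpow_max {a b : ℝ} (ha : 1 ≤ a) (hb : 1 ≤ b) (s t : ℝ) :
    a ^ s * b ^ t ≤ (a * b) ^ max s t := by
  rw [Real.mul_rpow (by positivity) (by positivity)]
  gcongr
  exacts [le_max_left s t, le_max_right s t]

theorem card_gridCell_rpow (d i : ℕ) :
    (Fintype.card (GridCell d i) : ℝ) ^ (2 / 3 : ℝ) = ((2 : ℝ) ^ i) ^ (2 * (d : ℝ) / 3) := by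
  rw [Fintype.card_fun, Fintype.card_fin, Fintype.card_fin, Nat.cast_pow, Nat.cast_pow,
    Nat.cast_ofNat, ← Real.rpow_natCast, ← Real.rpow_mul (by positivity)]
  congr 1
  ring

section SampleComplexity

variable {d : ℕ} {Δ ε : ℝ}

theorem numScales_le_log (hΔ : 0 < Δ) (hε : 0 < ε) :
    (numScales d Δ ε : ℝ) ≤ 3 * Real.log (2 + 2 * Δ * d / ε) :=
  ceil_logb_le_log (by positivity)

theorem numScales_le_log_of_le_three (hd : d ≤ 3) (hΔ : 0 < Δ) (hε : 0 < ε) :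
    (numScales d Δ ε : ℝ) ≤ 9 * Real.log (2 + Δ / ε) := by
  have hy : 0 < Δ / ε := by positivity
  have hd' : (d : ℝ) ≤ 3 := mod_cast hd
  have h_cube : 2 + 2 * Δ * d / ε ≤ (2 + Δ / ε) ^ 3 :=
    calc 2 + 2 * Δ * d / ε ≤ 2 + 2 * Δ * 3 / ε := by gcongr
      _ = 2 + 6 * (Δ / ε) := by ring
      _ ≤ (2 + Δ / ε) ^ 3 := by nlinarith [pow_pos hy 3]
  have h_log := Real.log_le_log (by positivity) h_cube
  rw [Real.log_pow, Nat.cast_ofNat] at h_log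
  linarith [numScales_le_log (d := d) hΔ hε]

variable (hΔ : 0 < Δ) (hε : 0 < ε)
include hΔ hε

theorem numScales_pow_mul_two_pow_rpow_le {k : ℕ} (hk : k ≠ 0) {s : ℝ} (hs : 0 ≤ s) :
    (numScales d Δ ε : ℝ) ^ k * (2 ^ numScales d Δ ε) ^ s ≤
      (numScales d Δ ε : ℝ) ^ k * (2 * (2 * Δ * d / ε)) ^ s := by
  rcases le_total (2 * Δ * d / ε) 1 with hx | hx
  · rw [numScales, ceil_logb_eq_zero (by positivity) hx]
    simp [hk]
  · gcongr
    exact two_pow_ceil_logb_le hx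

theorem div_scaleDist_sq_le {i : ℕ} (hi : i ∈ List.range' 1 (numScales d Δ ε)) :
    26 / (scaleDist d Δ ε i ^ 2 * (1 / (3 * numScales d Δ ε))) ≤
      312 * (numScales d Δ ε : ℝ) ^ 3 * (2 ^ (numScales d Δ ε - i)) ^ 2 := by
  have hL := numScales_pos_of_mem_range' hi
  have hd := dim_pos_of_numScales_pos hL
  have h2L := le_two_pow_ceil_logb (2 * Δ * d / ε)
  rw [← numScales] at h2L
  rw [List.mem_range'_1] at hi
  unfold scaleDist
  set L := numScales d Δ ε
  calc _ = 312 * (L : ℝ) ^ 3 * ((2 * Δ * d / ε) / 2 ^ i) ^ 2 := by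
        rw [zpow_sub₀ two_ne_zero, zpow_natCast]
        field_simp
        norm_num
    _ ≤ 312 * (L : ℝ) ^ 3 * (2 ^ L / 2 ^ i) ^ 2 := by gcongr
    _ = _ := by rw [pow_sub₀ _ two_ne_zero (by omega), div_eq_mul_inv]

theorem samples_scaleTest_flatTester_le {i : ℕ} (hi : i ∈ List.range' 1 (numScales d Δ ε)) :
    (scaleTest flatTester d Δ ε i).samples ≤
      (⌊2504 * (numScales d Δ ε : ℝ) ^ 3 *
        (2 ^ numScales d Δ ε) ^ max (2 * (d : ℝ) / 3) 2⌋₊ : ℕ∞) := by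
  have hL := numScales_pos_of_mem_range' hi
  have h_inv := div_scaleDist_sq_le hΔ hε hi
  refine (SampleAlg.samples_comap_le _ _).trans
    ((samples_flatTester_le (scaleDist_pos hΔ hε hL i) (by positivity)).trans
      (Nat.cast_le.2 (Nat.floor_le_floor ?_)))
  rw [List.mem_range'_1] at hi
  rw [card_gridCell_rpow]
  set L := numScales d Δ ε
  have h_one_le : 1 ≤ (L : ℝ) ^ 3 * (2 ^ (L - i)) ^ 2 :=
    one_le_mul_of_one_le_of_one_le (one_le_pow₀ (mod_cast hL))
      (one_le_pow₀ (one_le_pow₀ one_le_two))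
  calc _ ≤ 8 * ((2 : ℝ) ^ i) ^ (2 * (d : ℝ) / 3) * (313 * ((L : ℝ) ^ 3 * (2 ^ (L - i)) ^ 2)) := by
        gcongr
        linarith
    _ = 2504 * (L : ℝ) ^ 3 * (((2 : ℝ) ^ i) ^ (2 * (d : ℝ) / 3) * (2 ^ (L - i)) ^ (2 : ℝ)) := by
        rw [Real.rpow_two]
        ring
    _ ≤ 2504 * (L : ℝ) ^ 3 * ((2 : ℝ) ^ i * 2 ^ (L - i)) ^ max (2 * (d : ℝ) / 3) 2 := by
        gcongr
        exact rpow_mul_rpow_le_mul_rpow_max (one_le_pow₀ one_le_two) (one_le_pow₀ one_le_two) _ _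
    _ = _ := by rw [← pow_add, Nat.add_sub_cancel' (by omega)]

theorem samples_emdClosenessTester_flatTester_le :
    (emdClosenessTester flatTester d Δ ε).samples ≤
      (⌊2504 * (numScales d Δ ε : ℝ) ^ 4 *
        (2 ^ numScales d Δ ε) ^ max (2 * (d : ℝ) / 3) 2⌋₊ : ℕ∞) := by
  rw [emdClosenessTester_eq_allAccept]
  convert SampleAlg.samples_allAccept_le_floor (l := (List.range' 1 (numScales d Δ ε)).map
    (scaleTest flatTester d Δ ε)) (by positivity)
    (List.forall_mem_map.2 fun i hi => samples_scaleTest_flatTester_le hΔ hε hi) using 3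
  rw [List.length_map, List.length_range']
  ring

theorem samples_emdClosenessTester_flatTester_le_two_pow (hd : 3 ≤ d) :
    (emdClosenessTester flatTester d Δ ε).samples ≤
      (⌊2504 * 3 ^ 4 * ((2 : ℝ) ^ numScales d Δ ε) ^ (2 * (d : ℝ) / 3) *
        (d * Real.log (2 + 2 * Δ * d / ε)) ^ 4⌋₊ : ℕ∞) := by
  refine (samples_emdClosenessTester_flatTester_le hΔ hε).trans
    (Nat.cast_le.2 (Nat.floor_le_floor ?_))
  have hd' : (3 : ℝ) ≤ d := mod_cast hd
  have h_log : 0 ≤ Real.log (2 + 2 * Δ * d / ε) :=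
    Real.log_nonneg (by linarith [show 0 ≤ 2 * Δ * d / ε by positivity])
  rw [max_eq_left (by linarith)]
  calc _ ≤ 2504 * (3 * Real.log (2 + 2 * Δ * d / ε)) ^ 4 *
        (2 ^ numScales d Δ ε) ^ (2 * (d : ℝ) / 3) := by
        gcongr
        exact numScales_le_log hΔ hε
    _ ≤ 2504 * (3 * (d * Real.log (2 + 2 * Δ * d / ε))) ^ 4 *
        (2 ^ numScales d Δ ε) ^ (2 * (d : ℝ) / 3) := by
        gcongr
        exact le_mul_of_one_le_left h_log (by linarith)
    _ = _ := by ring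

theorem samples_emdClosenessTester_flatTester_le_rpow (hd : 3 ≤ d) :
    (emdClosenessTester flatTester d Δ ε).samples ≤
      (⌊2504 * 3 ^ 4 * 2 ^ (2 * (d : ℝ) / 3) * (2 * Δ * d / ε) ^ (2 * (d : ℝ) / 3) *
        Real.log (2 + 2 * Δ * d / ε) ^ 4⌋₊ : ℕ∞) := by
  refine (samples_emdClosenessTester_flatTester_le hΔ hε).trans
    (Nat.cast_le.2 (Nat.floor_le_floor ?_))
  have hd' : (3 : ℝ) ≤ d := mod_cast hd
  rw [max_eq_left (by linarith), mul_assoc]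
  calc _ ≤ 2504 * ((numScales d Δ ε : ℝ) ^ 4 * (2 * (2 * Δ * d / ε)) ^ (2 * (d : ℝ) / 3)) := by
        gcongr 2504 * ?_
        exact numScales_pow_mul_two_pow_rpow_le hΔ hε four_ne_zero (by positivity)
    _ ≤ 2504 * ((3 * Real.log (2 + 2 * Δ * d / ε)) ^ 4 *
        (2 * (2 * Δ * d / ε)) ^ (2 * (d : ℝ) / 3)) := by
        gcongr
        exact numScales_le_log hΔ hε
    _ = _ := by
        rw [Real.mul_rpow two_pos.le (by positivity)]
        ring

theorem samples_emdClosenessTester_flatTester_le_sq (hd : d ≤ 3) :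
    (emdClosenessTester flatTester d Δ ε).samples ≤
      (⌊2504 * 12 ^ 2 * 9 ^ 4 * (Δ / ε) ^ 2 * Real.log (2 + Δ / ε) ^ 4⌋₊ : ℕ∞) := by
  refine (samples_emdClosenessTester_flatTester_le hΔ hε).trans
    (Nat.cast_le.2 (Nat.floor_le_floor ?_))
  have hd' : (d : ℝ) ≤ 3 := mod_cast hd
  rw [max_eq_right (by linarith), mul_assoc]
  calc _ ≤ 2504 * ((numScales d Δ ε : ℝ) ^ 4 * (2 * (2 * Δ * d / ε)) ^ (2 : ℝ)) := by
        gcongr 2504 * ?_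
        exact numScales_pow_mul_two_pow_rpow_le hΔ hε four_ne_zero zero_le_two
    _ ≤ 2504 * ((9 * Real.log (2 + Δ / ε)) ^ 4 * (2 * (2 * Δ * 3 / ε)) ^ (2 : ℝ)) := by
        gcongr
        exact numScales_le_log_of_le_three hd hΔ hε
    _ = _ := by
        rw [Real.rpow_two]
        ring

end SampleComplexity

theorem theorem12_general :
    (∀ T : L1Subroutine, IsL1ClosenessTester T →
      ∀ (d : ℕ) (Δ : ℝ), 0 < Δ →
      ∀ M : Finset (L1Space d), (∀ x ∈ M, ∀ j, x j ∈ Set.Icc 0 Δ) →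
        IsEMDClosenessTester (M := M)
          fun ε => (emdClosenessTester T d Δ ε).comap Subtype.val) ∧
    (∃ T : L1Subroutine, IsL1ClosenessTester T ∧ ∃ k : ℕ,
      (∀ d : ℕ, 3 ≤ d → ∃ C : ℝ, ∀ Δ ε : ℝ, 0 < Δ → 0 < ε →
        (emdClosenessTester T d Δ ε).samples ≤
          (⌊C * (2 * Δ * d / ε) ^ (2 * (d : ℝ) / 3) *
            Real.log (2 + 2 * Δ * d / ε) ^ k⌋₊ : ℕ∞)) ∧
      (∃ C : ℝ, ∀ d : ℕ, 3 ≤ d → ∀ Δ ε : ℝ, 0 < Δ → 0 < ε →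
        (emdClosenessTester T d Δ ε).samples ≤
          (⌊C * ((2 : ℝ) ^ numScales d Δ ε) ^ (2 * (d : ℝ) / 3) *
            (d * Real.log (2 + 2 * Δ * d / ε)) ^ k⌋₊ : ℕ∞)) ∧
      (∃ C : ℝ, ∀ d : ℕ, d ≤ 3 → ∀ Δ ε : ℝ, 0 < Δ → 0 < ε →
        (emdClosenessTester T d Δ ε).samples ≤
          (⌊C * (Δ / ε) ^ 2 * Real.log (2 + Δ / ε) ^ k⌋₊ : ℕ∞))) :=
  ⟨fun _ hT _ _ hΔ _ hM => isEMDClosenessTester_emdClosenessTester hT hΔ hM,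
    flatTester, isL1ClosenessTester_flatTester, 4,
    fun _ hd => ⟨_, fun _ _ hΔ hε => samples_emdClosenessTester_flatTester_le_rpow hΔ hε hd⟩,
    ⟨_, fun _ hd _ _ hΔ hε => samples_emdClosenessTester_flatTester_le_two_pow hΔ hε hd⟩,
    ⟨_, fun _ hd _ _ hΔ hε => samples_emdClosenessTester_flatTester_le_sq hΔ hε hd⟩⟩

theorem theorem12 :
    -- correctness, for every choice of the `ℓ₁`-closeness tester used as a subroutine
    (∀ T : L1Subroutine, IsL1ClosenessTester T →
      ∀ (d : ℕ) (Δ : ℝ), 0 < Δ →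
      ∀ M : Finset (L1Space d), (∀ x ∈ M, ∀ j, x j ∈ Set.Icc 0 Δ) →
        IsEMDClosenessTester (M := M)
          fun ε => (emdClosenessTester T d Δ ε).comap Subtype.val) ∧
    -- sample complexity, for a suitable choice of the subroutine
    (∃ T : L1Subroutine, IsL1ClosenessTester T ∧ ∃ k : ℕ,
      -- fixed `d ≥ 6`
      (∀ d : ℕ, 6 ≤ d → ∃ C : ℝ, ∀ Δ ε : ℝ, 0 < Δ → 0 < ε →
        (emdClosenessTester T d Δ ε).samples ≤
          (⌊C * (2 * Δ * d / ε) ^ (2 * (d : ℝ) / 3) *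
            Real.log (2 + 2 * Δ * d / ε) ^ k⌋₊ : ℕ∞)) ∧
      -- uniformly in `d ≥ 6`, with `2Δd/ε` rounded up to a power of two
      (∃ C : ℝ, ∀ d : ℕ, 6 ≤ d → ∀ Δ ε : ℝ, 0 < Δ → 0 < ε →
        (emdClosenessTester T d Δ ε).samples ≤
          (⌊C * ((2 : ℝ) ^ numScales d Δ ε) ^ (2 * (d : ℝ) / 3) *
            (d * Real.log (2 + 2 * Δ * d / ε)) ^ k⌋₊ : ℕ∞)) ∧
      -- `d ≤ 2`
      (∃ C : ℝ, ∀ d : ℕ, d ≤ 2 → ∀ Δ ε : ℝ, 0 < Δ → 0 < ε →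
        (emdClosenessTester T d Δ ε).samples ≤
          (⌊C * (Δ / ε) ^ 2 * Real.log (2 + Δ / ε) ^ k⌋₊ : ℕ∞))) := by
  obtain ⟨h_correct, T, hT, k, h_fixed, ⟨C, h_uniform⟩, ⟨C', h_low⟩⟩ := theorem12_general
  exact ⟨h_correct, T, hT, k, fun d hd => h_fixed d (by omega),
    ⟨C, fun d hd => h_uniform d (by omega)⟩, ⟨C', fun d hd => h_low d (by omega)⟩⟩
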